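/- **Setting.** Let $\mathbf{Cat}$ be the category of small categories and functors, and let $\mathbf{DblCat}=\mathsf{Cat}(\mathbf{Cat})$ be the category of small (strict) double categories and double functors, i.e. of internal categories and internal functors in $\mathbf{Cat}$. Such a $\mathbb{D}$ consists of a category $\mathbb{D}_0$ (objects and vertical morphisms) and a category $\mathbb{D}_1$ (horizontal morphisms and squares) with source, target, unit and horizontal composition functors $s,t:\mathbb{D}_1\to\mathbb{D}_0$, $u:\mathbb{D}_0\to\mathbb{D}_1$, $m:\mathbb{D}_1\times_{\mathbb{D}_0}\mathbb{D}_1\to\mathbb{D}_1$. Write $\mathsf{iso}(\mathbb{D})_1\subseteq\mathbb{D}_1$ for the subcategory of horizontally invertible horizontal morphisms and horizontally invertible squares. For a double functor $F:\mathbb{A}\to\mathbb{B}$ let $(\mathbb{P}_F)_0$ be the pullback of $F_0:\mathbb{A}_0\to\mathbb{B}_0$ and $t:\mathsf{iso}(\mathbb{B})_1\to\mathbb{B}_0$; its objects are the pairs $(a,\,b\cong F_0a)$. A functor is *simplicially surjective* if it is surjective in each degree of the nerve. The families consisting of one simplicially surjective functor form a basis of a Grothendieck topology $\tau$ on $\mathbf{Cat}$.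 A functor $p$ is *$\tau$-epi* if the Yoneda embedding followed by $\tau$-sheafification sends $p$ to an epimorphism of sheaves. A category $\mathbf{P}$ is *$\tau$-projective* if every functor $\mathbf{P}\to\mathbf{R}$ lifts along every $\tau$-epi functor $\mathbf{Q}\to\mathbf{R}$. A double functor $F:\mathbb{A}\to\mathbb{B}$ is * in $\mathsf{we}(\tau)$ (a *$\tau$-equivalence*) if the square with sides $F_1:\mathbb{A}_1\to\mathbb{B}_1$, $F_0\times F_0$ and the two functors $(s,t)$ is a pullback in $\mathbf{Cat}$, and the functor $(\mathbb{P}_F)_0\to\mathbb{B}_0$, $(a,\,b\cong F_0a)\mapsto b$, is $\tau$-epi; * in $\mathsf{fib}(\tau)$ if the functor $\mathsf{iso}(\mathbb{A})_1\to(\mathbb{P}_F)_0$ induced by $t$ and $\mathsf{iso}(F)_1$ is $\tau$-epi; * in $\mathsf{cof}(\tau)$ if it has the left lifting property with respect to all double functors in $\mathsf{fib}(\tau)\cap\mathsf{we}(\tau)$. **Theorem.** The category $\mathbf{DblCat}$ is complete and cocomplete, and $(\mathbf{DblCat},\mathsf{we}(\tau),\mathsf{fib}(\tau),\mathsf{cof}(\tau))$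 is a (closed) model category with weak equivalences $\mathsf{we}(\tau)$, fibrations $\mathsf{fib}(\tau)$ and cofibrations $\mathsf{cof}(\tau)$; in particular $\mathsf{we}(\tau)$ has the 2-out-of-3 property. Moreover, a double functor $F:\mathbb{A}\to\mathbb{B}$ is a $\tau$-equivalence if and only if its vertical nerve is levelwise an equivalence: for every $k\ge 0$ the functor $(N_v\mathbb{A})_k\to(N_v\mathbb{B})_k$ induced by $F$ is an equivalence of categories, where $(N_v\mathbb{D})_k$ has the functors $[k]\to\mathbb{D}_0$ as objects, the functors $[k]\to\mathbb{D}_1$ as morphisms, and horizontal composition. Finally, $\mathbf{Cat}$ has enough $\tau$-projectives: every small category $\mathbf{C}$ admits a $\tau$-epi functor $\mathbf{P}\to\mathbf{C}$ with $\mathbf{P}$ $\tau$-projective. -/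

import Mathlib

open CategoryTheory Limits Opposite

universe v u

/-- An internal category (category object) in a category `C` with finite limits: an object of
objects, an object of morphisms, source, target, identities, and a composition defined on the
pullback of composable pairs `(f, g)`, `tgt f = src g` (first `f`, then `g`).
Associativity is written on generalized elements; by the Yoneda lemma it is equivalent to the
commutativity of the associativity diagram on the triple pullback `mor ×_obj mor ×_obj mor`. -/
structure InternalCat (C : Type u) [Category.{v} C] [HasFiniteLimits C] where
  obj : C
  mor : C
  src : mor ⟶ obj
  tgt : mor ⟶ obj
  unit : obj ⟶ mor
  comp : pullback tgt src ⟶ mor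
  unit_src : unit ≫ src = 𝟙 obj
  unit_tgt : unit ≫ tgt = 𝟙 obj
  comp_src : comp ≫ src = pullback.fst tgt src ≫ src
  comp_tgt : comp ≫ tgt = pullback.snd tgt src ≫ tgt
  unit_comp : pullback.lift (src ≫ unit) (𝟙 mor)
    (by rw [Category.assoc, unit_tgt, Category.comp_id, Category.id_comp]) ≫ comp = 𝟙 mor
  comp_unit : pullback.lift (𝟙 mor) (tgt ≫ unit)
    (by rw [Category.assoc, unit_src, Category.comp_id, Category.id_comp]) ≫ comp = 𝟙 mor
  assoc : ∀ {X : C} (f g h : X ⟶ mor) (hfg : f ≫ tgt = g ≫ src) (hgh : g ≫ tgt = h ≫ src),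
    pullback.lift (pullback.lift f g hfg ≫ comp) h
        (by rw [Category.assoc, comp_tgt, pullback.lift_snd_assoc, hgh]) ≫ comp =
      pullback.lift f (pullback.lift g h hgh ≫ comp)
        (by rw [Category.assoc, comp_src, pullback.lift_fst_assoc, hfg]) ≫ comp

namespace InternalCat

variable {C : Type u} [Category.{v} C] [HasFiniteLimits C]

/-- Composition of composable generalized elements of the object of morphisms. -/
noncomputable def mul (D : InternalCat C) {X : C} (f g : X ⟶ D.mor)
    (h : f ≫ D.tgt = g ≫ D.src) : X ⟶ D.mor :=
  pullback.lift f g h ≫ D.comp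

lemma mul_src (D : InternalCat C) {X : C} (f g : X ⟶ D.mor) (h : f ≫ D.tgt = g ≫ D.src) :
    D.mul f g h ≫ D.src = f ≫ D.src := by
  rw [mul, Category.assoc, D.comp_src, pullback.lift_fst_assoc]

lemma mul_tgt (D : InternalCat C) {X : C} (f g : X ⟶ D.mor) (h : f ≫ D.tgt = g ≫ D.src) :
    D.mul f g h ≫ D.tgt = g ≫ D.tgt := by
  rw [mul, Category.assoc, D.comp_tgt, pullback.lift_snd_assoc]

lemma comp_mul (D : InternalCat C) {X Y : C} (k : Y ⟶ X) (f g : X ⟶ D.mor)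
    (h : f ≫ D.tgt = g ≫ D.src) :
    k ≫ D.mul f g h = D.mul (k ≫ f) (k ≫ g) (by rw [Category.assoc, h, Category.assoc]) := by
  rw [mul, mul, ← Category.assoc]
  congr 1
  apply pullback.hom_ext <;> simp [pullback.lift_fst, pullback.lift_snd]

lemma mul_assoc (D : InternalCat C) {X : C} (f g h : X ⟶ D.mor)
    (hfg : f ≫ D.tgt = g ≫ D.src) (hgh : g ≫ D.tgt = h ≫ D.src) :
    D.mul (D.mul f g hfg) h (by rw [mul_tgt, hgh]) =
      D.mul f (D.mul g h hgh) (by rw [mul_src, hfg]) :=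
  D.assoc f g h hfg hgh

lemma unit_mul (D : InternalCat C) {X : C} (f : X ⟶ D.mor) :
    D.mul (f ≫ D.src ≫ D.unit) f (by simp [D.unit_tgt]) = f := by
  have := congrArg (fun k => f ≫ k) D.unit_comp
  simp only [Category.comp_id] at this
  rw [← this, ← Category.assoc f, mul]
  congr 1
  apply pullback.hom_ext <;>
    simp [this, pullback.lift_fst, pullback.lift_snd]

lemma mul_unit (D : InternalCat C) {X : C} (f : X ⟶ D.mor) :
    D.mul f (f ≫ D.tgt ≫ D.unit) (by simp [D.unit_src]) = f := by
  have := congrArg (fun k => f ≫ k) D.comp_unit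
  simp only [Category.comp_id] at this
  rw [← this, ← Category.assoc f, mul]
  congr 1
  apply pullback.hom_ext <;>
    simp [this, pullback.lift_fst, pullback.lift_snd]

/-- Internal functors. -/
@[ext]
structure Hom (D E : InternalCat C) where
  onObj : D.obj ⟶ E.obj
  onMor : D.mor ⟶ E.mor
  onMor_src : onMor ≫ E.src = D.src ≫ onObj
  onMor_tgt : onMor ≫ E.tgt = D.tgt ≫ onObj
  unit_onMor : D.unit ≫ onMor = onObj ≫ E.unit
  comp_onMor : D.comp ≫ onMor =
    pullback.lift (pullback.fst D.tgt D.src ≫ onMor) (pullback.snd D.tgt D.src ≫ onMor)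
      (by rw [Category.assoc, Category.assoc, onMor_tgt, onMor_src, pullback.condition_assoc]) ≫
        E.comp

lemma Hom.mul_onMor {D E : InternalCat C} (F : Hom D E) {X : C} (f g : X ⟶ D.mor)
    (h : f ≫ D.tgt = g ≫ D.src) :
    D.mul f g h ≫ F.onMor = E.mul (f ≫ F.onMor) (g ≫ F.onMor)
      (by rw [Category.assoc, Category.assoc, F.onMor_tgt, F.onMor_src, reassoc_of% h]) := by
  rw [mul, Category.assoc, F.comp_onMor, mul, ← Category.assoc]
  congr 1
  apply pullback.hom_ext <;>
    simp [pullback.lift_fst, pullback.lift_snd, pullback.lift_fst_assoc, pullback.lift_snd_assoc]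

/-- The category of internal categories and internal functors in `C`. -/
instance : Category (InternalCat C) where
  Hom := Hom
  id D :=
    { onObj := 𝟙 _
      onMor := 𝟙 _
      onMor_src := by simp
      onMor_tgt := by simp
      unit_onMor := by simp
      comp_onMor := by
        rw [Category.comp_id]
        refine (Category.id_comp D.comp).symm.trans ?_
        congr 1
        apply pullback.hom_ext <;> simp }
  comp {D E K} F G :=
    { onObj := F.onObj ≫ G.onObj
      onMor := F.onMor ≫ G.onMor
      onMor_src := by
        rw [Category.assoc, G.onMor_src, reassoc_of% F.onMor_src]
      onMor_tgt := by
        rw [Category.assoc, G.onMor_tgt, reassoc_of% F.onMor_tgt]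
      unit_onMor := by
        rw [reassoc_of% F.unit_onMor, G.unit_onMor, Category.assoc]
      comp_onMor := by
        rw [reassoc_of% F.comp_onMor, G.comp_onMor, ← Category.assoc]
        congr 1
        apply pullback.hom_ext <;> simp [pullback.lift_fst, pullback.lift_snd,
          pullback.lift_fst_assoc, pullback.lift_snd_assoc] }
  id_comp F := by apply Hom.ext <;> apply Category.id_comp
  comp_id F := by apply Hom.ext <;> apply Category.comp_id
  assoc F G H := by apply Hom.ext <;> apply Category.assoc

/-! ### The object of invertible morphisms -/

/-- The object of pairs `(f, g)` of morphisms in opposite directions: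
`src f = tgt g` and `tgt f = src g`. -/
noncomputable def oppositePairs (D : InternalCat C) : C :=
  pullback (prod.lift D.src D.tgt) (prod.lift D.tgt D.src)

/-- The projection `(f, g) ↦ f`. -/
noncomputable def oppFst (D : InternalCat C) : D.oppositePairs ⟶ D.mor :=
  pullback.fst (prod.lift D.src D.tgt) (prod.lift D.tgt D.src)

/-- The projection `(f, g) ↦ g`. -/
noncomputable def oppSnd (D : InternalCat C) : D.oppositePairs ⟶ D.mor :=
  pullback.snd (prod.lift D.src D.tgt) (prod.lift D.tgt D.src)

lemma oppFst_src (D : InternalCat C) : D.oppFst ≫ D.src = D.oppSnd ≫ D.tgt := by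
  have := congrArg (fun k => k ≫ prod.fst)
    (pullback.condition (f := prod.lift D.src D.tgt) (g := prod.lift D.tgt D.src))
  simp only [Category.assoc, prod.lift_fst] at this
  exact this

lemma oppFst_tgt (D : InternalCat C) : D.oppFst ≫ D.tgt = D.oppSnd ≫ D.src := by
  have := congrArg (fun k => k ≫ prod.snd)
    (pullback.condition (f := prod.lift D.src D.tgt) (g := prod.lift D.tgt D.src))
  simp only [Category.assoc, prod.lift_snd] at this
  exact this

/-- `iso(D)₁`, the object of invertible morphisms of `D`: the object of pairs `(f, g)` such that
`f` followed by `g` and `g` followed by `f` are identities. An inverse is unique, so that this is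
a subobject of `D.mor` via `isoι`. For `C = Cat` it is the subcategory of `D.mor` of horizontally
invertible horizontal morphisms and horizontally invertible squares. -/
noncomputable def isoObj (D : InternalCat C) : C :=
  equalizer
    (prod.lift (D.mul D.oppFst D.oppSnd D.oppFst_tgt) (D.mul D.oppSnd D.oppFst D.oppFst_src.symm))
    (prod.lift (D.oppFst ≫ D.src ≫ D.unit) (D.oppFst ≫ D.tgt ≫ D.unit))

/-- The inclusion of `iso(D)₁` in the object of pairs of opposite morphisms. -/
noncomputable def isoToPairs (D : InternalCat C) : D.isoObj ⟶ D.oppositePairs :=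
  equalizer.ι _ _

/-- The inclusion `(f, f⁻¹) ↦ f` of the invertible morphisms. -/
noncomputable def isoι (D : InternalCat C) : D.isoObj ⟶ D.mor := D.isoToPairs ≫ D.oppFst

/-- The inverse `(f, f⁻¹) ↦ f⁻¹`. -/
noncomputable def isoInv (D : InternalCat C) : D.isoObj ⟶ D.mor := D.isoToPairs ≫ D.oppSnd

lemma isoι_src (D : InternalCat C) : D.isoι ≫ D.src = D.isoInv ≫ D.tgt := by
  rw [isoι, isoInv, Category.assoc, Category.assoc, D.oppFst_src]

lemma isoι_tgt (D : InternalCat C) : D.isoι ≫ D.tgt = D.isoInv ≫ D.src := by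
  rw [isoι, isoInv, Category.assoc, Category.assoc, D.oppFst_tgt]

lemma isoToPairs_condition (D : InternalCat C) :
    D.isoToPairs ≫ prod.lift (D.mul D.oppFst D.oppSnd D.oppFst_tgt)
        (D.mul D.oppSnd D.oppFst D.oppFst_src.symm) =
      D.isoToPairs ≫ prod.lift (D.oppFst ≫ D.src ≫ D.unit) (D.oppFst ≫ D.tgt ≫ D.unit) :=
  equalizer.condition _ _

lemma isoι_mul_isoInv (D : InternalCat C) :
    D.mul D.isoι D.isoInv D.isoι_tgt = D.isoι ≫ D.src ≫ D.unit := by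
  have := congrArg (fun k => k ≫ prod.fst) D.isoToPairs_condition
  simp only [Category.assoc, prod.lift_fst] at this
  rw [comp_mul] at this
  exact this.trans (Category.assoc _ _ _).symm

lemma isoInv_mul_isoι (D : InternalCat C) :
    D.mul D.isoInv D.isoι D.isoι_src.symm = D.isoι ≫ D.tgt ≫ D.unit := by
  have := congrArg (fun k => k ≫ prod.snd) D.isoToPairs_condition
  simp only [Category.assoc, prod.lift_snd] at this
  rw [comp_mul] at this
  exact this.trans (Category.assoc _ _ _).symm

/-- The generalized element of the object of opposite pairs given by `f` and `g`. -/
noncomputable def pairsLift (D : InternalCat C) {X : C} (f g : X ⟶ D.mor)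
    (h₁ : f ≫ D.src = g ≫ D.tgt) (h₂ : f ≫ D.tgt = g ≫ D.src) : X ⟶ D.oppositePairs :=
  pullback.lift f g (by rw [prod.comp_lift, prod.comp_lift, h₁, h₂])

lemma pairsLift_fst (D : InternalCat C) {X : C} (f g : X ⟶ D.mor)
    (h₁ : f ≫ D.src = g ≫ D.tgt) (h₂ : f ≫ D.tgt = g ≫ D.src) :
    D.pairsLift f g h₁ h₂ ≫ D.oppFst = f := pullback.lift_fst _ _ _

lemma pairsLift_snd (D : InternalCat C) {X : C} (f g : X ⟶ D.mor)
    (h₁ : f ≫ D.src = g ≫ D.tgt) (h₂ : f ≫ D.tgt = g ≫ D.src) :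
    D.pairsLift f g h₁ h₂ ≫ D.oppSnd = g := pullback.lift_snd _ _ _

/-- The generalized element of `iso(D)₁` given by mutually inverse generalized elements. -/
noncomputable def isoLift (D : InternalCat C) {X : C} (f g : X ⟶ D.mor)
    (h₁ : f ≫ D.src = g ≫ D.tgt) (h₂ : f ≫ D.tgt = g ≫ D.src)
    (hfg : D.mul f g h₂ = f ≫ D.src ≫ D.unit) (hgf : D.mul g f h₁.symm = f ≫ D.tgt ≫ D.unit) :
    X ⟶ D.isoObj :=
  equalizer.lift (D.pairsLift f g h₁ h₂) (by
    rw [prod.comp_lift, prod.comp_lift, comp_mul, comp_mul]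
    simp only [pairsLift_fst, pairsLift_snd, hfg, hgf, reassoc_of% D.pairsLift_fst f g h₁ h₂])

lemma isoLift_isoι (D : InternalCat C) {X : C} (f g : X ⟶ D.mor)
    (h₁ : f ≫ D.src = g ≫ D.tgt) (h₂ : f ≫ D.tgt = g ≫ D.src)
    (hfg : D.mul f g h₂ = f ≫ D.src ≫ D.unit) (hgf : D.mul g f h₁.symm = f ≫ D.tgt ≫ D.unit) :
    D.isoLift f g h₁ h₂ hfg hgf ≫ D.isoι = f := by
  have : D.isoLift f g h₁ h₂ hfg hgf ≫ D.isoToPairs = D.pairsLift f g h₁ h₂ :=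
    equalizer.lift_ι _ _
  rw [isoι, ← Category.assoc, this, pairsLift_fst]

/-- Source of an invertible morphism. -/
noncomputable def isoSrc (D : InternalCat C) : D.isoObj ⟶ D.obj := D.isoι ≫ D.src

/-- Target of an invertible morphism. -/
noncomputable def isoTgt (D : InternalCat C) : D.isoObj ⟶ D.obj := D.isoι ≫ D.tgt

/-- The map `iso(F)₁ : iso(D)₁ ⟶ iso(E)₁` induced by an internal functor,
`(f, f⁻¹) ↦ (F f, F f⁻¹)`. -/
noncomputable def isoMap {D E : InternalCat C} (F : D ⟶ E) : D.isoObj ⟶ E.isoObj :=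
  E.isoLift (D.isoι ≫ F.onMor) (D.isoInv ≫ F.onMor)
    (by rw [Category.assoc, Category.assoc, F.onMor_src, F.onMor_tgt, reassoc_of% D.isoι_src])
    (by rw [Category.assoc, Category.assoc, F.onMor_src, F.onMor_tgt, reassoc_of% D.isoι_tgt])
    (by
      rw [← Hom.mul_onMor F _ _ D.isoι_tgt, isoι_mul_isoInv]
      simp only [Category.assoc]
      rw [F.unit_onMor, reassoc_of% F.onMor_src])
    (by
      rw [← Hom.mul_onMor F _ _ D.isoι_src.symm, isoInv_mul_isoι]
      simp only [Category.assoc]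
      rw [F.unit_onMor, reassoc_of% F.onMor_tgt])

lemma isoMap_isoι {D E : InternalCat C} (F : D ⟶ E) :
    isoMap F ≫ E.isoι = D.isoι ≫ F.onMor :=
  E.isoLift_isoι _ _ _ _ _ _

/-- The mapping path object `(P_F)₀` of `F : D ⟶ E`: the pullback of `F₀ : D₀ ⟶ E₀` and the target
map `iso(E)₁ ⟶ E₀`. For `C = Cat` its objects are the pairs `(a, b ≅ F a)`. -/
noncomputable abbrev mappingPath {D E : InternalCat C} (F : D ⟶ E) : C :=
  pullback F.onObj E.isoTgt

/-- The map `(P_F)₀ ⟶ E₀`, `(a, b ≅ F a) ↦ b`. -/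
noncomputable def mappingPathSrc {D E : InternalCat C} (F : D ⟶ E) : mappingPath F ⟶ E.obj :=
  pullback.snd F.onObj E.isoTgt ≫ E.isoSrc

/-- The map `(r_F)₀ : iso(D)₁ ⟶ (P_F)₀`, `(a' ≅ a) ↦ (a, F a' ≅ F a)`. -/
noncomputable def mappingPathLift {D E : InternalCat C} (F : D ⟶ E) :
    D.isoObj ⟶ mappingPath F :=
  pullback.lift D.isoTgt (isoMap F) (by
    rw [isoTgt, isoTgt, ← Category.assoc, isoMap_isoι, Category.assoc, Category.assoc,
      F.onMor_tgt])

/-- An internal functor `F` is fully faithful if the square with sides `F₁`, `F₀ × F₀` and the two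
maps `(src, tgt)` is a pullback. -/
def FullyFaithful {D E : InternalCat C} (F : D ⟶ E) : Prop :=
  IsPullback F.onMor (prod.lift D.src D.tgt) (prod.lift E.src E.tgt)
    (prod.map F.onObj F.onObj)

end InternalCat

/-! ### The classes of maps determined by a Grothendieck topology -/

/-- A morphism `p` is a `J`-epimorphism if its image under the Yoneda embedding followed by
sheafification is an epimorphism of `J`-sheaves. (The presheaves take values in a universe which
contains the objects of `C`, so that sheafification exists on the possibly large site `C`.) -/
def IsTopologyEpi {C : Type u} [Category.{v} C] (J : GrothendieckTopology C) {E B : C}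
    (p : E ⟶ B) : Prop :=
  Epi ((presheafToSheaf J (Type (max u v))).map (uliftYoneda.{u}.map p))

/-- An object is `J`-projective if it has the lifting property against all `J`-epimorphisms. -/
def IsTopologyProjective {C : Type u} [Category.{v} C] (J : GrothendieckTopology C) (P : C) :
    Prop :=
  ∀ ⦃Q R : C⦄ (G : Q ⟶ R), IsTopologyEpi J G → ∀ H : P ⟶ R, ∃ F : P ⟶ Q, F ≫ G = H

/-- There are enough `J`-projectives. -/
def EnoughTopologyProjectives {C : Type u} [Category.{v} C] (J : GrothendieckTopology C) : Prop :=
  ∀ X : C, ∃ (P : C) (p : P ⟶ X), IsTopologyProjective J P ∧ IsTopologyEpi J p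

namespace InternalCat

variable {C : Type u} [Category.{v} C] [HasFiniteLimits C] (J : GrothendieckTopology C)

/-- `we(J)`: the `J`-equivalences, i.e. the fully faithful and essentially `J`-surjective internal
functors. -/
def we : MorphismProperty (InternalCat C) := fun _ _ F =>
  FullyFaithful F ∧ IsTopologyEpi J (mappingPathSrc F)

/-- `fib(J)`: the `J`-fibrations. -/
def fib : MorphismProperty (InternalCat C) := fun _ _ F =>
  IsTopologyEpi J (mappingPathLift F)

/-- `cof(J)`: the `J`-cofibrations, i.e. the internal functors with the left lifting property with
respect to all `J`-fibrations which are `J`-equivalences. -/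
def cof : MorphismProperty (InternalCat C) := (fib J ⊓ we J).llp

end InternalCat

/-! ### The simplicially surjective topology on `Cat` -/

/-- A functor between small categories is simplicially surjective if it is surjective in every
degree of the nerve. -/
def SimpliciallySurjective {A B : Cat.{u, u}} (F : A ⟶ B) : Prop :=
  ∀ k : ℕ, Function.Surjective ((nerveMap F.toFunctor).app (op (SimplexCategory.mk k)))

/-- The category `[k] = {0 < 1 < ⋯ < k}`, as a small category in the universe `u`. -/
abbrev ordinalCat (k : ℕ) : Cat.{u, u} := Cat.of (ULift.{u} (Fin (k + 1)))

/-- Simplicial surjectivity says that functors out of the categories `[k]` lift. -/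
lemma simpliciallySurjective_iff {A B : Cat.{u, u}} (F : A ⟶ B) :
    SimpliciallySurjective F ↔
      ∀ (k : ℕ) (x : ordinalCat.{u} k ⟶ B), ∃ y : ordinalCat.{u} k ⟶ A, y ≫ F = x := by
  have hup : ∀ k : ℕ, Monotone (ULift.up.{u} : Fin (k + 1) → ULift.{u} (Fin (k + 1))) :=
    fun _ _ _ h => h
  constructor
  · intro hF k x
    have hdown : Monotone (ULift.down : ULift.{u} (Fin (k + 1)) → Fin (k + 1)) := fun _ _ h => h
    obtain ⟨y, hy⟩ := hF k ((hup k).functor ⋙ x.toFunctor)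
    refine ⟨(hdown.functor ⋙ (y : Fin (k + 1) ⥤ A)).toCatHom, ?_⟩
    have hy : (y : Fin (k + 1) ⥤ A) ⋙ F.toFunctor = (hup k).functor ⋙ x.toFunctor := hy
    apply Cat.Hom.ext
    exact congrArg (fun G => hdown.functor ⋙ G) hy
  · intro hF k x
    have hdown : Monotone (ULift.down : ULift.{u} (Fin (k + 1)) → Fin (k + 1)) := fun _ _ h => h
    obtain ⟨y, hy⟩ := hF k (hdown.functor ⋙ (x : Fin (k + 1) ⥤ B)).toCatHom
    refine ⟨(hup k).functor ⋙ y.toFunctor, ?_⟩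
    have hy : y.toFunctor ⋙ F.toFunctor = hdown.functor ⋙ (x : Fin (k + 1) ⥤ B) :=
      congrArg Cat.Hom.toFunctor hy
    exact congrArg (fun G => (hup k).functor ⋙ G) hy

/-- The basis whose covering families are the single simplicially surjective functors. -/
def simpliciallySurjectiveBasis : Pretopology Cat.{u, u} where
  coverings X := {R | ∃ (Y : Cat.{u, u}) (F : Y ⟶ X),
    SimpliciallySurjective F ∧ R = Presieve.singleton F}
  has_isos X Y f hf := by
    refine ⟨Y, f, ?_, rfl⟩
    rw [simpliciallySurjective_iff]
    exact fun k x => ⟨x ≫ inv f, by simp⟩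
  pullbacks := by
    rintro X Y f _ ⟨Z, F, hF, rfl⟩
    refine ⟨_, pullback.snd F f, ?_, Presieve.pullback_singleton _ _⟩
    rw [simpliciallySurjective_iff] at hF ⊢
    intro k x
    obtain ⟨y, hy⟩ := hF k (x ≫ f)
    exact ⟨pullback.lift y x hy, pullback.lift_snd _ _ _⟩
  transitive := by
    rintro X _ Ti ⟨Y, F, hF, rfl⟩ hTi
    obtain ⟨Z, G, hG, hR⟩ := hTi F (Presieve.singleton_self F)
    refine ⟨Z, G ≫ F, ?_, ?_⟩
    · rw [simpliciallySurjective_iff] at hF hG ⊢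
      intro k x
      obtain ⟨y, rfl⟩ := hF k x
      obtain ⟨z, rfl⟩ := hG k y
      exact ⟨z, by simp⟩
    · funext W
      ext g
      constructor
      · rintro ⟨V, a, b, ⟨⟩, hb, rfl⟩
        rw [hR] at hb
        obtain ⟨⟩ := hb
        exact Presieve.singleton_self _
      · rintro ⟨⟩
        exact ⟨_, G, F, Presieve.singleton_self F, hR ▸ Presieve.singleton_self G, rfl⟩

/-- The simplicially surjective topology `τ` on `Cat`. -/
def simpliciallySurjectiveTopology : GrothendieckTopology Cat.{u, u} :=
  simpliciallySurjectiveBasis.toGrothendieck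

/-! ### Double categories and the vertical nerve -/

/-- Small double categories and double functors: internal categories in `Cat`. The category `D.obj`
consists of objects and vertical morphisms, the category `D.mor` of horizontal morphisms and
squares (composed vertically); `D.comp` is the horizontal composition. -/
abbrev DblCat : Type (u + 1) := InternalCat Cat.{u, u}

namespace DblCat

/-- The `k`-th category of the vertical nerve: its objects are the functors `[k] ⟶ D.obj`, i.e.
the strings of `k` composable vertical morphisms. -/
structure VerticalNerve (D : DblCat.{u}) (k : ℕ) : Type u where
  pt : ordinalCat.{u} k ⟶ D.obj

/-- The morphisms of the `k`-th category of the vertical nerve are the functors `[k] ⟶ D.mor`, i.e.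
the strings of `k` vertically composable squares; composition is horizontal. -/
noncomputable instance (D : DblCat.{u}) (k : ℕ) : Category.{u} (D.VerticalNerve k) where
  Hom a b := {f : ordinalCat.{u} k ⟶ D.mor // f ≫ D.src = a.pt ∧ f ≫ D.tgt = b.pt}
  id a := ⟨a.pt ≫ D.unit, by simp [D.unit_src], by simp [D.unit_tgt]⟩
  comp f g := ⟨D.mul f.1 g.1 (f.2.2.trans g.2.1.symm),
    (D.mul_src _ _ _).trans f.2.1, (D.mul_tgt _ _ _).trans g.2.2⟩
  id_comp {a b} f := by
    obtain ⟨a⟩ := a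
    obtain ⟨f, h, -⟩ := f
    dsimp only at h
    subst h
    apply Subtype.ext
    simpa only [Category.assoc] using D.unit_mul f
  comp_id {a b} f := by
    obtain ⟨b⟩ := b
    obtain ⟨f, -, h⟩ := f
    dsimp only at h
    subst h
    apply Subtype.ext
    simpa only [Category.assoc] using D.mul_unit f
  assoc f g h := Subtype.ext (D.mul_assoc _ _ _ _ _)

/-- The functor induced by a double functor on the `k`-th categories of the vertical nerves. -/
noncomputable def verticalNerveMap {D E : DblCat.{u}} (F : D ⟶ E) (k : ℕ) :
    D.VerticalNerve k ⥤ E.VerticalNerve k where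
  obj a := ⟨a.pt ≫ F.onObj⟩
  map f := ⟨f.1 ≫ F.onMor,
    by rw [Category.assoc, F.onMor_src, ← Category.assoc, f.2.1],
    by rw [Category.assoc, F.onMor_tgt, ← Category.assoc, f.2.2]⟩
  map_id a := Subtype.ext (by
    change (a.pt ≫ D.unit) ≫ F.onMor = (a.pt ≫ F.onObj) ≫ E.unit
    rw [Category.assoc, F.unit_onMor, Category.assoc])
  map_comp f g := Subtype.ext (InternalCat.Hom.mul_onMor F _ _ _)

end DblCat

-- The classes `we`, `fib` and `cof` are governed by τ-epimorphisms, and these are exactly the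
-- functors along which every functor out of an ordinal [k] lifts (`isTopologyEpi_iff_liftsFrom`).
-- Essential surjectivity and the lifting of isomorphisms thus become statements about generalized
-- elements defined on [k], that is, about strings of vertical morphisms and horizontally invertible
-- strings of squares.
--
-- An internal functor lifts along a fully faithful one as soon as its object part does. Hence the
-- trivial fibrations are the fully faithful functors whose object part is τ-epi (`fib_inf_we_iff`),
-- and a functor which on objects is a coproduct inclusion A₀ → A₀ ⊔ P with P projective is a
-- cofibration. Restricting B along A₀ ⊔ P → B₀, where P → B₀ is a τ-epi from a projective, factors
-- F as a cofibration followed by a trivial fibration. For the other factorization, P covers the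
-- mapping path object (P_F)₀ instead, and A is restricted along A₀ ⊔ P → A₀. The resulting E has a
-- fully faithful retraction r onto A, and its functor to B is r followed by F, conjugated by the
-- tautological isomorphisms b ≅ F a. Conjugation (`conj`) also produces the lifts of A → E against
-- fibrations (`exists_lift_of_retraction`), and the retract argument extends them to all trivial
-- cofibrations.
--
-- Two-out-of-three comes from the vertical nerve. The nerve of categories reflects isomorphisms, so
-- full faithfulness is tested on strings, and a τ-equivalence is the same as a levelwise
-- equivalence (`we_iff_isEquivalence`); equivalences of categories have the property.
--
-- Limits are computed on objects and on morphisms. Colimits come from the adjoint functor theorem: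
-- a cocone factors through the double subcategory generated by its legs, whose arrows are named by
-- formal terms in a fixed set (`exists_small_factorization`). Coproducts of ordinals provide enough
-- projectives.

universe w

/-! ### Calculus of generalized elements of an internal category. -/

namespace InternalCat

variable {C : Type u} [Category.{v} C] [HasFiniteLimits C]

lemma unit_src_assoc (D : InternalCat C) {Z : C} (k : D.obj ⟶ Z) : D.unit ≫ D.src ≫ k = k :=
  (reassoc_of% D.unit_src) k

lemma unit_tgt_assoc (D : InternalCat C) {Z : C} (k : D.obj ⟶ Z) : D.unit ≫ D.tgt ≫ k = k :=
  (reassoc_of% D.unit_tgt) k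

lemma mul_src_assoc (D : InternalCat C) {X Z : C} (f g : X ⟶ D.mor) (h : f ≫ D.tgt = g ≫ D.src)
    (k : D.obj ⟶ Z) : D.mul f g h ≫ D.src ≫ k = f ≫ D.src ≫ k :=
  (reassoc_of% D.mul_src f g h) k

lemma mul_tgt_assoc (D : InternalCat C) {X Z : C} (f g : X ⟶ D.mor) (h : f ≫ D.tgt = g ≫ D.src)
    (k : D.obj ⟶ Z) : D.mul f g h ≫ D.tgt ≫ k = g ≫ D.tgt ≫ k :=
  (reassoc_of% D.mul_tgt f g h) k

lemma Hom.onMor_src_assoc {D E : InternalCat C} (F : Hom D E) {Z : C} (k : E.obj ⟶ Z) :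
    F.onMor ≫ E.src ≫ k = D.src ≫ F.onObj ≫ k :=
  (reassoc_of% F.onMor_src) k

lemma Hom.onMor_tgt_assoc {D E : InternalCat C} (F : Hom D E) {Z : C} (k : E.obj ⟶ Z) :
    F.onMor ≫ E.tgt ≫ k = D.tgt ≫ F.onObj ≫ k :=
  (reassoc_of% F.onMor_tgt) k

@[simp] lemma id_onObj (D : InternalCat C) : Hom.onObj (𝟙 D) = 𝟙 D.obj := rfl

@[simp] lemma id_onMor (D : InternalCat C) : Hom.onMor (𝟙 D) = 𝟙 D.mor := rfl

@[simp] lemma comp_onObj {D E K : InternalCat C} (F : D ⟶ E) (G : E ⟶ K) :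
    Hom.onObj (F ≫ G) = F.onObj ≫ G.onObj := rfl

@[simp] lemma comp_onMor' {D E K : InternalCat C} (F : D ⟶ E) (G : E ⟶ K) :
    Hom.onMor (F ≫ G) = F.onMor ≫ G.onMor := rfl

lemma hom_ext {D E : InternalCat C} {F G : D ⟶ E} (h₀ : F.onObj = G.onObj)
    (h₁ : F.onMor = G.onMor) : F = G := Hom.ext h₀ h₁

lemma unit_mul_of (D : InternalCat C) {X : C} {a : X ⟶ D.obj} {f : X ⟶ D.mor}
    (h : f ≫ D.src = a) :
    D.mul (a ≫ D.unit) f (by rw [Category.assoc, D.unit_tgt, Category.comp_id, h]) = f := by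
  subst h
  simpa only [Category.assoc] using D.unit_mul f

lemma mul_unit_of (D : InternalCat C) {X : C} {a : X ⟶ D.obj} {f : X ⟶ D.mor}
    (h : f ≫ D.tgt = a) :
    D.mul f (a ≫ D.unit) (by rw [Category.assoc, D.unit_src, Category.comp_id, h]) = f := by
  subst h
  simpa only [Category.assoc] using D.mul_unit f

lemma mul_mul_eq (D : InternalCat C) {X : C} (f g h : X ⟶ D.mor) (hfg : f ≫ D.tgt = g ≫ D.src)
    (hh : D.mul f g hfg ≫ D.tgt = h ≫ D.src) :
    D.mul (D.mul f g hfg) h hh = D.mul f (D.mul g h (by rw [← hh, mul_tgt]))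
      (by rw [mul_src, hfg]) :=
  D.mul_assoc _ _ _ _ _

/-- The composition is determined by the products of generalized elements. -/
lemma comp_eq_mul (D : InternalCat C) :
    D.comp = D.mul (pullback.fst D.tgt D.src) (pullback.snd D.tgt D.src) pullback.condition := by
  have : pullback.lift (pullback.fst D.tgt D.src) (pullback.snd D.tgt D.src)
      pullback.condition = 𝟙 _ := by
    apply pullback.hom_ext <;> simp
  rw [mul, this, Category.id_comp]

/-- An internal functor, from the preservation of products of generalized elements. -/
def homOfMul {D E : InternalCat C} (onObj : D.obj ⟶ E.obj) (onMor : D.mor ⟶ E.mor)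
    (onMor_src : onMor ≫ E.src = D.src ≫ onObj) (onMor_tgt : onMor ≫ E.tgt = D.tgt ≫ onObj)
    (unit_onMor : D.unit ≫ onMor = onObj ≫ E.unit)
    (mul_onMor : ∀ {X : C} (f g : X ⟶ D.mor) (h : f ≫ D.tgt = g ≫ D.src),
      D.mul f g h ≫ onMor = E.mul (f ≫ onMor) (g ≫ onMor)
        (by rw [Category.assoc, Category.assoc, onMor_tgt, onMor_src, reassoc_of% h])) :
    D ⟶ E :=
  { onObj := onObj
    onMor := onMor
    onMor_src := onMor_src
    onMor_tgt := onMor_tgt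
    unit_onMor := unit_onMor
    comp_onMor := by
      rw [comp_eq_mul D, mul_onMor]
      rfl }

/-! ### Invertible generalized elements -/

/-- Two generalized elements of the object of morphisms are mutually inverse. -/
structure IsInv (D : InternalCat C) {X : C} (f g : X ⟶ D.mor) : Prop where
  src : f ≫ D.src = g ≫ D.tgt
  tgt : f ≫ D.tgt = g ≫ D.src
  mul_inv : D.mul f g tgt = f ≫ D.src ≫ D.unit
  inv_mul : D.mul g f src.symm = f ≫ D.tgt ≫ D.unit

namespace IsInv

variable {D E : InternalCat C} {X Y : C}

lemma symm {f g : X ⟶ D.mor} (h : D.IsInv f g) : D.IsInv g f where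
  src := h.tgt.symm
  tgt := h.src.symm
  mul_inv := by rw [h.inv_mul, reassoc_of% h.tgt]
  inv_mul := by rw [h.mul_inv, reassoc_of% h.src]

lemma comp {f g : X ⟶ D.mor} (h : D.IsInv f g) (k : Y ⟶ X) : D.IsInv (k ≫ f) (k ≫ g) where
  src := by rw [Category.assoc, h.src, Category.assoc]
  tgt := by rw [Category.assoc, h.tgt, Category.assoc]
  mul_inv := by rw [← comp_mul _ k _ _ h.tgt, h.mul_inv, Category.assoc]
  inv_mul := by rw [← comp_mul _ k _ _ h.src.symm, h.inv_mul, Category.assoc]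

lemma map {f g : X ⟶ D.mor} (h : D.IsInv f g) (F : D ⟶ E) :
    E.IsInv (f ≫ F.onMor) (g ≫ F.onMor) where
  src := by rw [Category.assoc, Category.assoc, F.onMor_src, F.onMor_tgt, reassoc_of% h.src]
  tgt := by rw [Category.assoc, Category.assoc, F.onMor_src, F.onMor_tgt, reassoc_of% h.tgt]
  mul_inv := by
    rw [← Hom.mul_onMor F f g h.tgt, h.mul_inv]
    simp only [Category.assoc, F.unit_onMor, F.onMor_src_assoc]
  inv_mul := by
    rw [← Hom.mul_onMor F g f h.src.symm, h.inv_mul]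
    simp only [Category.assoc, F.unit_onMor, F.onMor_tgt_assoc]

lemma mul_inv_mul {f g : X ⟶ D.mor} (h : D.IsInv f g) {z : X ⟶ D.mor}
    (hz : g ≫ D.tgt = z ≫ D.src) :
    D.mul f (D.mul g z hz) (by rw [mul_src, h.tgt]) = z := by
  rw [← D.mul_assoc f g z h.tgt hz]
  simp only [h.mul_inv]
  simpa only [Category.assoc] using D.unit_mul_of (a := f ≫ D.src) (by rw [h.src, hz])

lemma mul_mul_inv {f g : X ⟶ D.mor} (h : D.IsInv f g) {z : X ⟶ D.mor}
    (hz : z ≫ D.tgt = f ≫ D.src) :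
    D.mul (D.mul z f hz) g (by rw [mul_tgt, h.tgt]) = z := by
  rw [D.mul_assoc z f g hz h.tgt]
  simp only [h.mul_inv]
  simpa only [Category.assoc] using D.mul_unit_of hz

/-- Both `g` and `g'` are equal to the triple product of `g`, `f` and `g'`. -/
lemma unique {f g g' : X ⟶ D.mor} (h : D.IsInv f g) (h' : D.IsInv f g') : g = g' := by
  have h₁ := h.symm.mul_inv_mul (z := g') h'.tgt
  have h₂ : D.mul g (D.mul f g' h'.tgt) (by rw [mul_src, h.src]) = g := by
    simp only [h'.mul_inv]
    simpa only [Category.assoc] using D.mul_unit_of h.src.symm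
  exact h₂.symm.trans h₁

lemma unit (a : X ⟶ D.obj) : D.IsInv (a ≫ D.unit) (a ≫ D.unit) where
  src := by simp [D.unit_src, D.unit_tgt]
  tgt := by simp [D.unit_src, D.unit_tgt]
  mul_inv := by
    rw [D.unit_mul_of (by simp [D.unit_src])]
    simp [D.unit_src_assoc]
  inv_mul := by
    rw [D.unit_mul_of (by simp [D.unit_src])]
    simp [D.unit_tgt_assoc]

lemma mul {f g f' g' : X ⟶ D.mor} (h : D.IsInv f g) (h' : D.IsInv f' g')
    (hf : f ≫ D.tgt = f' ≫ D.src) :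
    D.IsInv (D.mul f f' hf) (D.mul g' g (by rw [← h'.src, ← hf, h.tgt])) where
  src := by rw [mul_src, mul_tgt, h.src]
  tgt := by rw [mul_src, mul_tgt, h'.tgt]
  mul_inv := by
    rw [D.mul_assoc _ _ _ hf (by rw [mul_src, h'.tgt])]
    simp only [h'.mul_inv_mul (z := g) (by rw [← h'.src, ← hf, h.tgt]), h.mul_inv, mul_src_assoc]
  inv_mul := by
    rw [D.mul_assoc _ _ _ (by rw [← h'.src, ← hf, h.tgt]) (by rw [mul_src, h.src])]
    simp only [h.symm.mul_inv_mul (z := f') hf, h'.inv_mul, mul_tgt_assoc]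

/-- The generalized element of the object of invertible morphisms. -/
noncomputable def lift {f g : X ⟶ D.mor} (h : D.IsInv f g) : X ⟶ D.isoObj :=
  D.isoLift f g h.src h.tgt h.mul_inv h.inv_mul

lemma lift_isoι {f g : X ⟶ D.mor} (h : D.IsInv f g) : h.lift ≫ D.isoι = f :=
  D.isoLift_isoι _ _ _ _ _ _

end IsInv

lemma isInv_iso (D : InternalCat C) : D.IsInv D.isoι D.isoInv where
  src := D.isoι_src
  tgt := D.isoι_tgt
  mul_inv := D.isoι_mul_isoInv
  inv_mul := D.isoInv_mul_isoι

/-- Inverses are unique, so the first component of a pair of mutually inverse elements determines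
the second. Equalities of maps into `isoObj` can therefore be checked in `mor`. -/
instance (D : InternalCat C) : Mono D.isoι where
  right_cancellation {Z} x y h := by
    have hinv : x ≫ D.isoInv = y ≫ D.isoInv :=
      (D.isInv_iso.comp x).unique (h ▸ D.isInv_iso.comp y)
    have h₁ : x ≫ D.isoToPairs = y ≫ D.isoToPairs := by
      apply pullback.hom_ext
      · exact (Category.assoc _ _ _).trans (h.trans (Category.assoc _ _ _).symm)
      · exact (Category.assoc _ _ _).trans (hinv.trans (Category.assoc _ _ _).symm)
    exact (cancel_mono (equalizer.ι _ _)).1 h₁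

lemma mappingPathLift_fst {D E : InternalCat C} (F : D ⟶ E) :
    mappingPathLift F ≫ pullback.fst F.onObj E.isoTgt = D.isoι ≫ D.tgt :=
  pullback.lift_fst _ _ _

lemma mappingPathLift_snd {D E : InternalCat C} (F : D ⟶ E) :
    mappingPathLift F ≫ pullback.snd F.onObj E.isoTgt = isoMap F :=
  pullback.lift_snd _ _ _

lemma mappingPath_condition {D E : InternalCat C} (F : D ⟶ E) {X : C} (y : X ⟶ mappingPath F) :
    ((y ≫ pullback.snd F.onObj E.isoTgt) ≫ E.isoι) ≫ E.tgt =
      (y ≫ pullback.fst F.onObj E.isoTgt) ≫ F.onObj := by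
  have : pullback.snd F.onObj E.isoTgt ≫ E.isoι ≫ E.tgt = pullback.fst F.onObj E.isoTgt ≫ F.onObj :=
    pullback.condition.symm
  simp only [Category.assoc, this]

/-- The generalized element of the mapping path object given by `a` and an invertible `f`. -/
noncomputable def IsInv.path {D E : InternalCat C} {F : D ⟶ E} {X : C} {a : X ⟶ D.obj}
    {f g : X ⟶ E.mor} (h : E.IsInv f g) (h' : f ≫ E.tgt = a ≫ F.onObj) : X ⟶ mappingPath F :=
  pullback.lift a h.lift (by rw [isoTgt, reassoc_of% h.lift_isoι, h'])

lemma IsInv.path_fst {D E : InternalCat C} {F : D ⟶ E} {X : C} {a : X ⟶ D.obj}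
    {f g : X ⟶ E.mor} (h : E.IsInv f g) (h' : f ≫ E.tgt = a ≫ F.onObj) :
    h.path h' ≫ pullback.fst F.onObj E.isoTgt = a :=
  pullback.lift_fst _ _ _

lemma IsInv.path_snd {D E : InternalCat C} {F : D ⟶ E} {X : C} {a : X ⟶ D.obj}
    {f g : X ⟶ E.mor} (h : E.IsInv f g) (h' : f ≫ E.tgt = a ≫ F.onObj) :
    h.path h' ≫ pullback.snd F.onObj E.isoTgt = h.lift :=
  pullback.lift_snd _ _ _

/-- Generalized elements of `E.obj` which factor through `mappingPathSrc F`. -/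
lemma exists_comp_mappingPathSrc_iff {D E : InternalCat C} (F : D ⟶ E) {X : C} (b : X ⟶ E.obj) :
    (∃ y, y ≫ mappingPathSrc F = b) ↔ ∃ (a : X ⟶ D.obj) (f g : X ⟶ E.mor), E.IsInv f g ∧
      f ≫ E.src = b ∧ f ≫ E.tgt = a ≫ F.onObj := by
  constructor
  · rintro ⟨y, rfl⟩
    refine ⟨y ≫ pullback.fst _ _, _, _, E.isInv_iso.comp (y ≫ pullback.snd _ _), ?_, ?_⟩
    · simp only [mappingPathSrc, isoSrc, Category.assoc]
    · exact mappingPath_condition F y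
  · rintro ⟨a, f, g, h, rfl, h'⟩
    refine ⟨h.path h', ?_⟩
    rw [mappingPathSrc, reassoc_of% h.path_snd h', isoSrc, reassoc_of% h.lift_isoι]

/-- Generalized elements of the mapping path object which factor through `mappingPathLift F`. -/
lemma exists_comp_mappingPathLift_iff {D E : InternalCat C} (F : D ⟶ E) {X : C} :
    (∀ x : X ⟶ mappingPath F, ∃ y, y ≫ mappingPathLift F = x) ↔
      ∀ (a : X ⟶ D.obj) (f g : X ⟶ E.mor), E.IsInv f g → f ≫ E.tgt = a ≫ F.onObj →
        ∃ f' g' : X ⟶ D.mor, D.IsInv f' g' ∧ f' ≫ D.tgt = a ∧ f' ≫ F.onMor = f := by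
  constructor
  · intro H a f g h h'
    obtain ⟨y, hy⟩ := H (h.path h')
    refine ⟨_, _, D.isInv_iso.comp y, ?_, ?_⟩
    · rw [← h.path_fst h', ← hy, Category.assoc, Category.assoc, mappingPathLift_fst]
    · rw [← h.lift_isoι, ← h.path_snd h', ← hy]
      simp only [Category.assoc, reassoc_of% mappingPathLift_snd F, isoMap_isoι]
  · intro H x
    obtain ⟨f', g', h, h₁, h₂⟩ := H (x ≫ pullback.fst _ _) _ _
      (E.isInv_iso.comp (x ≫ pullback.snd _ _)) (mappingPath_condition F x)
    refine ⟨h.lift, ?_⟩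
    apply pullback.hom_ext
    · rw [Category.assoc, mappingPathLift_fst, reassoc_of% h.lift_isoι, h₁]
    · rw [← cancel_mono E.isoι, Category.assoc h.lift, mappingPathLift_snd, Category.assoc,
        isoMap_isoι, reassoc_of% h.lift_isoι, h₂]

end InternalCat

namespace InternalCat

variable {C : Type u} [Category.{v} C] [HasFiniteLimits C]

/-! ### Internal graphs whose category structure is detected by a family of internal categories -/

/-- An internal graph with units and a composition, together with a family of maps to internal
categories which jointly detect equality of parallel morphisms. -/
structure DetectedGraph (C : Type u) [Category.{v} C] [HasFiniteLimits C] where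
  obj : C
  mor : C
  src : mor ⟶ obj
  tgt : mor ⟶ obj
  unit : obj ⟶ mor
  comp : pullback tgt src ⟶ mor
  ι : Type w
  cat : ι → InternalCat C
  onObj (i : ι) : obj ⟶ (cat i).obj
  onMor (i : ι) : mor ⟶ (cat i).mor
  onMor_src (i : ι) : onMor i ≫ (cat i).src = src ≫ onObj i
  onMor_tgt (i : ι) : onMor i ≫ (cat i).tgt = tgt ≫ onObj i
  unit_src : unit ≫ src = 𝟙 obj
  unit_tgt : unit ≫ tgt = 𝟙 obj
  unit_onMor (i : ι) : unit ≫ onMor i = onObj i ≫ (cat i).unit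
  comp_src : comp ≫ src = pullback.fst tgt src ≫ src
  comp_tgt : comp ≫ tgt = pullback.snd tgt src ≫ tgt
  comp_onMor (i : ι) : comp ≫ onMor i =
    (cat i).mul (pullback.fst tgt src ≫ onMor i) (pullback.snd tgt src ≫ onMor i)
      (by rw [Category.assoc, Category.assoc, onMor_tgt, onMor_src, pullback.condition_assoc])
  ext {X : C} {f g : X ⟶ mor} (h₀ : f ≫ src = g ≫ src) (h₁ : f ≫ tgt = g ≫ tgt)
    (h : ∀ i, f ≫ onMor i = g ≫ onMor i) : f = g

namespace DetectedGraph

variable (G : DetectedGraph.{v, u, w} C)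

lemma lift_comp_onMor {X : C} (f g : X ⟶ G.mor) (h : f ≫ G.tgt = g ≫ G.src) (i : G.ι) :
    pullback.lift f g h ≫ G.comp ≫ G.onMor i = (G.cat i).mul (f ≫ G.onMor i) (g ≫ G.onMor i)
      (by rw [Category.assoc, Category.assoc, onMor_tgt, onMor_src, reassoc_of% h]) := by
  rw [comp_onMor, comp_mul]
  simp only [pullback.lift_fst_assoc, pullback.lift_snd_assoc]

/-- The internal category determined by a detected graph. -/
def toInternalCat : InternalCat C where
  obj := G.obj
  mor := G.mor
  src := G.src
  tgt := G.tgt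
  unit := G.unit
  comp := G.comp
  unit_src := G.unit_src
  unit_tgt := G.unit_tgt
  comp_src := G.comp_src
  comp_tgt := G.comp_tgt
  unit_comp := by
    -- By `ext`, each law reduces to its source, its target and its image in every `cat i`, where
    -- the law is known.
    refine G.ext ?_ ?_ fun i => ?_
    · simp only [Category.assoc, comp_src, pullback.lift_fst_assoc, unit_src, Category.comp_id,
        Category.id_comp]
    · simp only [Category.assoc, comp_tgt, pullback.lift_snd_assoc, Category.id_comp]
    · rw [Category.assoc, lift_comp_onMor]
      simp only [Category.assoc, unit_onMor, Category.id_comp, ← reassoc_of% G.onMor_src i]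
      exact (G.cat i).unit_mul _
  comp_unit := by
    refine G.ext ?_ ?_ fun i => ?_
    · simp only [Category.assoc, comp_src, pullback.lift_fst_assoc, Category.id_comp]
    · simp only [Category.assoc, comp_tgt, pullback.lift_snd_assoc, unit_tgt, Category.comp_id,
        Category.id_comp]
    · rw [Category.assoc, lift_comp_onMor]
      simp only [Category.assoc, unit_onMor, Category.id_comp, ← reassoc_of% G.onMor_tgt i]
      exact (G.cat i).mul_unit _
  assoc f g h hfg hgh := by
    refine G.ext ?_ ?_ fun i => ?_
    · simp only [Category.assoc, comp_src, pullback.lift_fst_assoc]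
    · simp only [Category.assoc, comp_tgt, pullback.lift_snd_assoc]
    · simp only [Category.assoc, lift_comp_onMor]
      exact (G.cat i).mul_assoc _ _ _ _ _

/-- The detecting internal functors. -/
def π (i : G.ι) : G.toInternalCat ⟶ G.cat i :=
  { onObj := G.onObj i
    onMor := G.onMor i
    onMor_src := G.onMor_src i
    onMor_tgt := G.onMor_tgt i
    unit_onMor := G.unit_onMor i
    comp_onMor := G.comp_onMor i }

section Lift

variable {A : InternalCat C} (F : ∀ i, A ⟶ G.cat i) (f₀ : A.obj ⟶ G.obj) (f₁ : A.mor ⟶ G.mor)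
  (h_src : f₁ ≫ G.src = A.src ≫ f₀) (h_tgt : f₁ ≫ G.tgt = A.tgt ≫ f₀)
  (h₀ : ∀ i, f₀ ≫ G.onObj i = (F i).onObj) (h₁ : ∀ i, f₁ ≫ G.onMor i = (F i).onMor)

include F h_src h_tgt h₀ h₁

lemma lift_unit : A.unit ≫ f₁ = f₀ ≫ G.unit := by
  refine G.ext ?_ ?_ fun i => ?_
  · simp only [Category.assoc, h_src, A.unit_src_assoc, G.unit_src, Category.comp_id]
  · simp only [Category.assoc, h_tgt, A.unit_tgt_assoc, G.unit_tgt, Category.comp_id]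
  · simp only [Category.assoc, h₁, G.unit_onMor, (F i).unit_onMor, reassoc_of% (h₀ i)]

omit h₀ in
lemma lift_comp : A.comp ≫ f₁ =
    pullback.lift (pullback.fst A.tgt A.src ≫ f₁) (pullback.snd A.tgt A.src ≫ f₁)
      (by rw [Category.assoc, Category.assoc, h_tgt, h_src, pullback.condition_assoc]) ≫
      G.comp := by
  rw [comp_eq_mul A]
  refine G.ext ?_ ?_ fun i => ?_
  · simp only [Category.assoc, h_src, mul_src_assoc, G.comp_src, pullback.lift_fst_assoc]
  · simp only [Category.assoc, h_tgt, mul_tgt_assoc, G.comp_tgt, pullback.lift_snd_assoc]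
  · simp only [Category.assoc, h₁, Hom.mul_onMor, G.lift_comp_onMor]

/-- An internal functor to a detected graph, from its underlying maps. -/
def lift : A ⟶ G.toInternalCat :=
  { onObj := f₀
    onMor := f₁
    onMor_src := h_src
    onMor_tgt := h_tgt
    unit_onMor := G.lift_unit F f₀ f₁ h_src h_tgt h₀ h₁
    comp_onMor := G.lift_comp F f₀ f₁ h_src h_tgt h₁ }

end Lift

end DetectedGraph

/-! ### Fully faithful internal functors -/

namespace FullyFaithful

variable {D E : InternalCat C} {F : D ⟶ E} (hF : FullyFaithful F)
include hF

lemma exists_lift {X : C} (f : X ⟶ E.mor) (a b : X ⟶ D.obj) (ha : f ≫ E.src = a ≫ F.onObj)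
    (hb : f ≫ E.tgt = b ≫ F.onObj) :
    ∃ g : X ⟶ D.mor, g ≫ D.src = a ∧ g ≫ D.tgt = b ∧ g ≫ F.onMor = f := by
  have w : f ≫ prod.lift E.src E.tgt = prod.lift a b ≫ prod.map F.onObj F.onObj := by
    rw [prod.comp_lift, prod.lift_map, ha, hb]
  have h := hF.lift_snd f (prod.lift a b) w
  refine ⟨hF.lift f (prod.lift a b) w, ?_, ?_, hF.lift_fst _ _ _⟩
  · simpa [prod.lift_fst] using congrArg (· ≫ prod.fst) h
  · simpa [prod.lift_snd] using congrArg (· ≫ prod.snd) h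

lemma ext {X : C} {f g : X ⟶ D.mor} (h₀ : f ≫ D.src = g ≫ D.src) (h₁ : f ≫ D.tgt = g ≫ D.tgt)
    (h : f ≫ F.onMor = g ≫ F.onMor) : f = g :=
  hF.hom_ext h (by rw [prod.comp_lift, prod.comp_lift, h₀, h₁])

/-- Mutually inverse generalized elements lift to mutually inverse ones. -/
lemma isInv {X : C} {f g : X ⟶ D.mor} (h₀ : f ≫ D.src = g ≫ D.tgt) (h₁ : f ≫ D.tgt = g ≫ D.src)
    (h : E.IsInv (f ≫ F.onMor) (g ≫ F.onMor)) : D.IsInv f g where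
  src := h₀
  tgt := h₁
  mul_inv := by
    refine hF.ext ?_ ?_ ?_
    · simp only [mul_src, Category.assoc, D.unit_src, Category.comp_id]
    · simp only [mul_tgt, Category.assoc, D.unit_tgt, Category.comp_id, h₀]
    · rw [Hom.mul_onMor, h.mul_inv]
      simp only [Category.assoc, F.unit_onMor, F.onMor_src_assoc]
  inv_mul := by
    refine hF.ext ?_ ?_ ?_
    · simp only [mul_src, Category.assoc, D.unit_src, Category.comp_id, h₁]
    · simp only [mul_tgt, Category.assoc, D.unit_tgt, Category.comp_id]
    · rw [Hom.mul_onMor, h.inv_mul]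
      simp only [Category.assoc, F.unit_onMor, F.onMor_tgt_assoc]

/-- Internal functors lift along a fully faithful internal functor as soon as their maps of objects
do. -/
lemma exists_lift_hom {A : InternalCat C} (K : A ⟶ E) (k : A.obj ⟶ D.obj)
    (hk : k ≫ F.onObj = K.onObj) : ∃ L : A ⟶ D, L.onObj = k ∧ L ≫ F = K := by
  obtain ⟨l, h₀, h₁, h⟩ := hF.exists_lift K.onMor (A.src ≫ k) (A.tgt ≫ k)
    (by rw [K.onMor_src, Category.assoc, hk]) (by rw [K.onMor_tgt, Category.assoc, hk])
  refine ⟨homOfMul k l h₀ h₁ ?_ ?_, rfl, hom_ext hk h⟩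
  · refine hF.ext ?_ ?_ ?_
    · simp only [Category.assoc, h₀, A.unit_src_assoc, D.unit_src, Category.comp_id]
    · simp only [Category.assoc, h₁, A.unit_tgt_assoc, D.unit_tgt, Category.comp_id]
    · simp only [Category.assoc, h, F.unit_onMor, K.unit_onMor, reassoc_of% hk]
  · intro X f g hfg
    refine hF.ext ?_ ?_ ?_
    · simp only [Category.assoc, h₀, mul_src_assoc, mul_src]
    · simp only [Category.assoc, h₁, mul_tgt_assoc, mul_tgt]
    · simp only [Category.assoc, h, Hom.mul_onMor]

omit hF in
lemma hom_ext_of_onObj (hF : FullyFaithful F) {A : InternalCat C} {K L : A ⟶ D}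
    (h₀ : K.onObj = L.onObj) (h : K ≫ F = L ≫ F) : K = L := by
  refine hom_ext h₀ (hF.ext ?_ ?_ (congrArg Hom.onMor h))
  · rw [K.onMor_src, L.onMor_src, h₀]
  · rw [K.onMor_tgt, L.onMor_tgt, h₀]

end FullyFaithful

/-! ### Restriction of an internal category along a map of objects. -/

section Restrict

variable (D : InternalCat C) {O : C} (φ : O ⟶ D.obj)

/-- The object of morphisms of the restriction of `D` along `φ : O ⟶ D.obj`. -/
noncomputable abbrev restrictMor : C := pullback (prod.lift D.src D.tgt) (prod.map φ φ)

lemma restrictMor_src :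
    pullback.fst (prod.lift D.src D.tgt) (prod.map φ φ) ≫ D.src =
      (pullback.snd (prod.lift D.src D.tgt) (prod.map φ φ) ≫ prod.fst) ≫ φ := by
  simpa [prod.lift_fst] using congrArg (· ≫ prod.fst)
    (pullback.condition (f := prod.lift D.src D.tgt) (g := prod.map φ φ))

lemma restrictMor_tgt :
    pullback.fst (prod.lift D.src D.tgt) (prod.map φ φ) ≫ D.tgt =
      (pullback.snd (prod.lift D.src D.tgt) (prod.map φ φ) ≫ prod.snd) ≫ φ := by
  simpa [prod.lift_snd] using congrArg (· ≫ prod.snd)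
    (pullback.condition (f := prod.lift D.src D.tgt) (g := prod.map φ φ))

/-- A generalized element of `restrictMor`. -/
noncomputable def restrictMorLift {X : C} (f : X ⟶ D.mor) (a b : X ⟶ O)
    (ha : f ≫ D.src = a ≫ φ) (hb : f ≫ D.tgt = b ≫ φ) : X ⟶ D.restrictMor φ :=
  pullback.lift f (prod.lift a b) (by rw [prod.comp_lift, prod.lift_map, ha, hb])

/-- The restriction of `D` along `φ : O ⟶ D.obj`, as a detected graph. -/
noncomputable def restrictGraph : DetectedGraph.{v, u, 0} C where
  obj := O
  mor := D.restrictMor φ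
  src := pullback.snd _ _ ≫ prod.fst
  tgt := pullback.snd _ _ ≫ prod.snd
  unit := D.restrictMorLift φ (φ ≫ D.unit) (𝟙 O) (𝟙 O) (by simp [D.unit_src])
    (by simp [D.unit_tgt])
  comp := D.restrictMorLift φ
    (D.mul (pullback.fst _ _ ≫ pullback.fst _ _) (pullback.snd _ _ ≫ pullback.fst _ _) (by
      rw [Category.assoc, Category.assoc, restrictMor_src, restrictMor_tgt,
        pullback.condition_assoc]))
    (pullback.fst _ _ ≫ pullback.snd _ _ ≫ prod.fst)
    (pullback.snd _ _ ≫ pullback.snd _ _ ≫ prod.snd)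
    (by rw [mul_src, Category.assoc, restrictMor_src]; simp only [Category.assoc])
    (by rw [mul_tgt, Category.assoc, restrictMor_tgt]; simp only [Category.assoc])
  ι := Unit
  cat _ := D
  onObj _ := φ
  onMor _ := pullback.fst _ _
  onMor_src _ := D.restrictMor_src φ
  onMor_tgt _ := D.restrictMor_tgt φ
  unit_src := by simp only [restrictMorLift, pullback.lift_snd_assoc, prod.lift_fst]
  unit_tgt := by simp only [restrictMorLift, pullback.lift_snd_assoc, prod.lift_snd]
  unit_onMor _ := by simp only [restrictMorLift, pullback.lift_fst]
  comp_src := by simp only [restrictMorLift, pullback.lift_snd_assoc, prod.lift_fst]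
  comp_tgt := by simp only [restrictMorLift, pullback.lift_snd_assoc, prod.lift_snd]
  comp_onMor _ := by simp only [restrictMorLift, pullback.lift_fst]
  ext {X f g} h₀ h₁ h := by
    apply pullback.hom_ext
    · exact h ()
    · apply Limits.prod.hom_ext
      · simpa only [Category.assoc] using h₀
      · simpa only [Category.assoc] using h₁

/-- The restriction of `D` along `φ : O ⟶ D.obj`. -/
noncomputable def restrict : InternalCat C := (D.restrictGraph φ).toInternalCat

/-- The fully faithful internal functor from the restriction of `D` along `φ`. -/
noncomputable def restrictHom : D.restrict φ ⟶ D := (D.restrictGraph φ).π ()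

lemma restrictHom_fullyFaithful : FullyFaithful (D.restrictHom φ) := by
  have : prod.lift (D.restrict φ).src (D.restrict φ).tgt =
      pullback.snd (prod.lift D.src D.tgt) (prod.map φ φ) := by
    apply Limits.prod.hom_ext
    · exact prod.lift_fst _ _
    · exact prod.lift_snd _ _
  rw [FullyFaithful, this]
  exact IsPullback.of_hasPullback _ _

end Restrict

/-! ### Conjugation of an internal functor by a family of invertible morphisms -/

section Conj

variable {A B : InternalCat C} (H : A ⟶ B) {θ θ' : A.obj ⟶ B.mor} (hθ : B.IsInv θ θ')
  (hH : θ ≫ B.tgt = H.onObj)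

include hθ hH

lemma conj_aux : H.onMor ≫ B.tgt = (A.tgt ≫ θ') ≫ B.src := by
  rw [H.onMor_tgt, Category.assoc, ← hθ.tgt, hH]

lemma conj_aux' : (A.src ≫ θ) ≫ B.tgt =
    B.mul H.onMor (A.tgt ≫ θ') (conj_aux H hθ hH) ≫ B.src := by
  rw [mul_src, H.onMor_src, Category.assoc, hH]

/-- The internal functor isomorphic to `H` via `θ`. -/
noncomputable def conj : A ⟶ B :=
  homOfMul (θ ≫ B.src)
    (B.mul (A.src ≫ θ) (B.mul H.onMor (A.tgt ≫ θ') (conj_aux H hθ hH)) (conj_aux' H hθ hH))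
    (by rw [mul_src, Category.assoc])
    (by rw [mul_tgt, mul_tgt, Category.assoc, hθ.src])
    (by
      simp only [comp_mul, A.unit_src_assoc, A.unit_tgt_assoc, H.unit_onMor]
      have : B.mul (H.onObj ≫ B.unit) θ' (by
          rw [Category.assoc, B.unit_tgt, Category.comp_id, ← hθ.tgt, hH]) = θ' :=
        B.unit_mul_of (by rw [← hθ.tgt, hH])
      simp only [this, hθ.mul_inv, Category.assoc])
    (by
      intro X f g h
      -- In the product of the two conjugates, the factor `θ'` at the target of `f` meets `θ` at the
      -- source of `g`; these are the same point of `A`, so the two factors cancel.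
      have h' : f ≫ A.tgt ≫ θ' = g ≫ A.src ≫ θ' := by rw [reassoc_of% h]
      have hs : θ' ≫ B.src = H.onObj := by rw [← hθ.tgt, hH]
      have hinv := (hθ.comp (g ≫ A.src)).symm
      simp only [Category.assoc] at hinv
      simp only [comp_mul, mul_src_assoc, mul_tgt_assoc, Hom.mul_onMor, h']
      simp only [mul_mul_eq]
      simp only [hinv.mul_inv_mul])

@[simp] lemma conj_onObj : (conj H hθ hH).onObj = θ ≫ B.src := rfl

lemma conj_onMor : (conj H hθ hH).onMor =
    B.mul (A.src ≫ θ) (B.mul H.onMor (A.tgt ≫ θ') (conj_aux H hθ hH)) (conj_aux' H hθ hH) := rfl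

/-- If `θ` is the identity on the image of `J`, then conjugating by `θ` changes nothing there. -/
lemma comp_conj {D : InternalCat C} (J : D ⟶ A) (h : J.onObj ≫ θ = J.onObj ≫ H.onObj ≫ B.unit) :
    J ≫ conj H hθ hH = J ≫ H := by
  -- The inverse of an identity is an identity, by uniqueness of inverses.
  have h' : J.onObj ≫ θ' = J.onObj ≫ H.onObj ≫ B.unit := by
    have h₁ := hθ.comp J.onObj
    have h₂ := IsInv.unit (D := B) (J.onObj ≫ H.onObj)
    rw [h] at h₁
    rw [Category.assoc] at h₂
    exact h₁.unique h₂
  apply hom_ext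
  · simp [reassoc_of% h, B.unit_src]
  · have e₁ : (D.src ≫ J.onObj) ≫ H.onObj = (J.onMor ≫ H.onMor) ≫ B.src := by
      simp only [Category.assoc, H.onMor_src, J.onMor_src_assoc]
    have e₂ : (D.tgt ≫ J.onObj) ≫ H.onObj = (J.onMor ≫ H.onMor) ≫ B.tgt := by
      simp only [Category.assoc, H.onMor_tgt, J.onMor_tgt_assoc]
    simp only [comp_onMor', conj_onMor, comp_mul, J.onMor_src_assoc, J.onMor_tgt_assoc, h, h']
    have h₃ := B.mul_unit_of (f := J.onMor ≫ H.onMor) e₂.symm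
    simp only [Category.assoc] at h₃
    simp only [h₃]
    have h₄ := B.unit_mul_of (f := J.onMor ≫ H.onMor) e₁.symm
    simpa only [Category.assoc] using h₄

end Conj

end InternalCat

/-- Every generalized element of the target defined on one of the objects `K i` lifts along `p`. -/
def LiftsFrom {C : Type u} [Category.{v} C] {ι : Type w} (K : ι → C) {E B : C} (p : E ⟶ B) :
    Prop :=
  ∀ (i : ι) (x : K i ⟶ B), ∃ y : K i ⟶ E, y ≫ p = x

/-- The maps `inl` and `inr` exhibit their target as a coproduct. -/
structure IsCoprod {C : Type u} [Category.{v} C] {A P S : C} (inl : A ⟶ S) (inr : P ⟶ S) :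
    Prop where
  exists_desc {X : C} (a : A ⟶ X) (p : P ⟶ X) : ∃ d : S ⟶ X, inl ≫ d = a ∧ inr ≫ d = p
  ext {X : C} {f g : S ⟶ X} (h : inl ≫ f = inl ≫ g) (h' : inr ≫ f = inr ≫ g) : f = g

/-! ### Coproduct inclusions on objects and their lifting properties. -/

namespace InternalCat

variable {C : Type u} [Category.{v} C] [HasFiniteLimits C]

lemma fullyFaithful_id (D : InternalCat C) : FullyFaithful (𝟙 D) := by
  rw [FullyFaithful, id_onObj, id_onMor, prod.map_id_id]
  exact IsPullback.id_horiz _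

/-- This is the common source of both factorizations: `E` is the restriction of `D` along the map
out of the coproduct. Only the universal property `IsCoprod` is recorded, since nothing else about
the objects of `E` is needed. -/
lemma exists_fullyFaithful_of_coprod [HasBinaryCoproducts C] (D : InternalCat C) {A P : C}
    (a : A ⟶ D.obj) (p : P ⟶ D.obj) :
    ∃ (E : InternalCat C) (q : E ⟶ D) (inl : A ⟶ E.obj) (inr : P ⟶ E.obj),
      FullyFaithful q ∧ IsCoprod inl inr ∧ inl ≫ q.onObj = a ∧ inr ≫ q.onObj = p :=
  ⟨D.restrict (coprod.desc a p), D.restrictHom _, (coprod.inl : A ⟶ A ⨿ P),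
    (coprod.inr : P ⟶ A ⨿ P), D.restrictHom_fullyFaithful _,
    { exists_desc := fun a p => ⟨coprod.desc a p, coprod.inl_desc _ _, coprod.inr_desc _ _⟩
      ext := fun h h' => coprod.hom_ext h h' }, coprod.inl_desc _ _, coprod.inr_desc _ _⟩

lemma _root_.IsCoprod.isInv {A P S : C} {inl : A ⟶ S} {inr : P ⟶ S} (hc : IsCoprod inl inr)
    {D : InternalCat C} {f g : S ⟶ D.mor} (hl : D.IsInv (inl ≫ f) (inl ≫ g))
    (hr : D.IsInv (inr ≫ f) (inr ≫ g)) : D.IsInv f g := by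
  have e₀ : f ≫ D.src = g ≫ D.tgt :=
    hc.ext (by simpa only [Category.assoc] using hl.src)
      (by simpa only [Category.assoc] using hr.src)
  have e₁ : f ≫ D.tgt = g ≫ D.src :=
    hc.ext (by simpa only [Category.assoc] using hl.tgt)
      (by simpa only [Category.assoc] using hr.tgt)
  refine ⟨e₀, e₁, hc.ext ?_ ?_, hc.ext ?_ ?_⟩
  · simpa only [comp_mul, Category.assoc] using hl.mul_inv
  · simpa only [comp_mul, Category.assoc] using hr.mul_inv
  · simpa only [comp_mul, Category.assoc] using hl.inv_mul
  · simpa only [comp_mul, Category.assoc] using hr.inv_mul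

section Lifting

variable {A E X Y : InternalCat C} {P : C} {j : A ⟶ E} {inr : P ⟶ E.obj}
  (hc : IsCoprod j.onObj inr)

include hc

/-- An internal functor whose map of objects is a coproduct inclusion with complement `P` has the
left lifting property with respect to fully faithful internal functors along whose maps of objects
the maps out of `P` lift. -/
lemma exists_lift_of_fullyFaithful {G : X ⟶ Y} (hG : FullyFaithful G)
    (hP : ∀ x : P ⟶ Y.obj, ∃ y : P ⟶ X.obj, y ≫ G.onObj = x) (a : A ⟶ X) (b : E ⟶ Y)
    (h : a ≫ G = j ≫ b) : ∃ l : E ⟶ X, j ≫ l = a ∧ l ≫ G = b := by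
  obtain ⟨y, hy⟩ := hP (inr ≫ b.onObj)
  obtain ⟨k, hk, hk'⟩ := hc.exists_desc a.onObj y
  have hkG : k ≫ G.onObj = b.onObj := by
    apply hc.ext
    · rw [reassoc_of% hk]
      exact congrArg Hom.onObj h
    · rw [reassoc_of% hk', hy]
  obtain ⟨l, hl, hlG⟩ := hG.exists_lift_hom b k hkG
  refine ⟨l, hG.hom_ext_of_onObj ?_ ?_, hlG⟩
  · rw [comp_onObj, hl, hk]
  · rw [Category.assoc, hlG, h]

/-- An internal functor whose map of objects is a coproduct inclusion with complement `P`, and which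
has a fully faithful retraction, has the left lifting property with respect to internal functors
`G` such that maps out of `P` lift along `mappingPathLift G`. -/
lemma exists_lift_of_retraction {r : E ⟶ A} (hr : FullyFaithful r) (hjr : j ≫ r = 𝟙 A) {G : X ⟶ Y}
    (hP : ∀ x : P ⟶ mappingPath G, ∃ y, y ≫ mappingPathLift G = x) (a : A ⟶ X) (b : E ⟶ Y)
    (h : a ≫ G = j ≫ b) : ∃ l : E ⟶ X, j ≫ l = a ∧ l ≫ G = b := by
  rw [exists_comp_mappingPathLift_iff] at hP
  have hjr₀ : j.onObj ≫ r.onObj = 𝟙 A.obj := congrArg Hom.onObj hjr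
  have hjr₁ : j.onMor ≫ r.onMor = 𝟙 A.mor := congrArg Hom.onMor hjr
  have h₀ : a.onObj ≫ G.onObj = j.onObj ≫ b.onObj := congrArg Hom.onObj h
  have h₁ : a.onMor ≫ G.onMor = j.onMor ≫ b.onMor := congrArg Hom.onMor h
  -- the canonical isomorphism from the identity of `E` to `r ≫ j`
  obtain ⟨ε, hε₀, hε₁, hε⟩ := hr.exists_lift (r.onObj ≫ A.unit) (𝟙 E.obj) (r.onObj ≫ j.onObj)
    (by simp [A.unit_src]) (by simp [A.unit_tgt, hjr₀])
  obtain ⟨ε', hε'₀, hε'₁, hε'⟩ := hr.exists_lift (r.onObj ≫ A.unit) (r.onObj ≫ j.onObj) (𝟙 E.obj)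
    (by simp [A.unit_src, hjr₀]) (by simp [A.unit_tgt])
  have hεε : E.IsInv ε ε' := hr.isInv (by rw [hε₀, hε'₁]) (by rw [hε₁, hε'₀])
    (by rw [hε, hε']; exact IsInv.unit _)
  -- Both sides have the same ends and are sent to identities by the fully faithful `r`.
  have hjε : j.onObj ≫ ε = j.onObj ≫ E.unit := by
    refine hr.ext ?_ ?_ ?_
    · simp [hε₀, E.unit_src]
    · simp [hε₁, E.unit_tgt, reassoc_of% hjr₀]
    · simp [hε, r.unit_onMor]
  -- At a point e of `P`, the image of ε under `b` is an isomorphism from b e to b j r e = G a r e.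
  -- The hypothesis on `G` lifts it to an isomorphism `f` with target a r e.
  obtain ⟨f, f', hf, hft, hfG⟩ := hP (inr ≫ r.onObj ≫ a.onObj) _ _
    ((hεε.map b).comp inr) (by simp [b.onMor_tgt, reassoc_of% hε₁, h₀])
  -- The family θ is the identity on `A` and the lifted isomorphism on `P`. Conjugating `r ≫ a` by
  -- it leaves the functor unchanged on `A` and moves the points of `P` into the fibres prescribed
  -- by `b`.
  obtain ⟨θ, hθl, hθr⟩ := hc.exists_desc (a.onObj ≫ X.unit) f
  obtain ⟨θ', hθ'l, hθ'r⟩ := hc.exists_desc (a.onObj ≫ X.unit) f'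
  have hθ : X.IsInv θ θ' := by
    apply hc.isInv
    · rw [hθl, hθ'l]
      exact IsInv.unit _
    · rwa [hθr, hθ'r]
  have hθt : θ ≫ X.tgt = (r ≫ a).onObj := by
    apply hc.ext
    · rw [reassoc_of% hθl, X.unit_tgt, Category.comp_id, comp_onObj, reassoc_of% hjr₀]
    · rw [reassoc_of% hθr, hft, comp_onObj]
  have hθG : θ ≫ G.onMor = ε ≫ b.onMor := by
    apply hc.ext
    · rw [reassoc_of% hθl, reassoc_of% hjε, G.unit_onMor, b.unit_onMor, reassoc_of% h₀]
    · rw [reassoc_of% hθr, hfG]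
  have hθ'G : θ' ≫ G.onMor = ε' ≫ b.onMor := by
    have := hεε.map b
    rw [← hθG] at this
    exact (hθ.map G).unique this
  refine ⟨conj (r ≫ a) hθ hθt, ?_, ?_⟩
  · rw [comp_conj, reassoc_of% hjr]
    rw [hθl, comp_onObj, Category.assoc, reassoc_of% hjr₀]
  · apply hom_ext
    · rw [comp_onObj, conj_onObj, Category.assoc, ← G.onMor_src, reassoc_of% hθG, b.onMor_src,
        reassoc_of% hε₀]
    · have e₁ : (r.onMor ≫ j.onMor) ≫ E.tgt = (E.tgt ≫ ε') ≫ E.src := by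
        simp only [Category.assoc, j.onMor_tgt, r.onMor_tgt_assoc, hε'₀]
      have e₂ : (E.src ≫ ε) ≫ E.tgt = E.mul (r.onMor ≫ j.onMor) (E.tgt ≫ ε') e₁ ≫ E.src := by
        simp only [mul_src, Category.assoc, hε₁, j.onMor_src, r.onMor_src_assoc]
      -- Conjugating `r ≫ j` by ε gives the identity of `E`: this can be checked after applying `r`,
      -- which sends ε and ε' to identities. Since `G` sends θ to the image of ε under `b`, applying
      -- `b` to this equation shows that the lift lies over `b`.
      have key : E.mul (E.src ≫ ε) (E.mul (r.onMor ≫ j.onMor) (E.tgt ≫ ε') e₁) e₂ = 𝟙 E.mor := by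
        refine hr.ext ?_ ?_ ?_
        · simp [mul_src, hε₀]
        · simp [mul_tgt, hε'₁]
        · simp only [Hom.mul_onMor, Category.assoc, hjr₁, hε, hε', Category.comp_id,
            Category.id_comp]
          have := A.mul_unit_of (f := r.onMor) r.onMor_tgt
          simp only [Category.assoc] at this
          simp only [this]
          simpa only [Category.assoc] using A.unit_mul_of (f := r.onMor) r.onMor_src
      have := congrArg (· ≫ b.onMor) key
      simp only [Hom.mul_onMor, Category.assoc, Category.id_comp] at this
      simp only [comp_onMor', conj_onMor, Hom.mul_onMor, Category.assoc, h₁, hθG, hθ'G, this]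

end Lifting

/-! ### Weak equivalences, fibrations and the two factorizations. -/

section Model

variable {ι : Type w} {K : ι → C} {J : GrothendieckTopology C}
  (hK : ∀ {E B : C} (p : E ⟶ B), IsTopologyEpi J p ↔ LiftsFrom K p)

include hK

lemma we_iff {D E : InternalCat C} (F : D ⟶ E) :
    we J F ↔ FullyFaithful F ∧ ∀ (i : ι) (b : K i ⟶ E.obj),
      ∃ (a : K i ⟶ D.obj) (f g : K i ⟶ E.mor), E.IsInv f g ∧ f ≫ E.src = b ∧
        f ≫ E.tgt = a ≫ F.onObj := by
  simp only [we, hK, LiftsFrom, exists_comp_mappingPathSrc_iff]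

lemma fib_iff {D E : InternalCat C} (F : D ⟶ E) :
    fib J F ↔ ∀ (i : ι) (a : K i ⟶ D.obj) (f g : K i ⟶ E.mor), E.IsInv f g →
      f ≫ E.tgt = a ≫ F.onObj →
        ∃ f' g' : K i ⟶ D.mor, D.IsInv f' g' ∧ f' ≫ D.tgt = a ∧ f' ≫ F.onMor = f := by
  simp only [fib, hK, LiftsFrom, exists_comp_mappingPathLift_iff]

/-- When objects lift strictly, identities serve as the required isomorphisms. -/
lemma we_of_fullyFaithful {D E : InternalCat C} {F : D ⟶ E} (hF : FullyFaithful F)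
    (h : LiftsFrom K F.onObj) : we J F := by
  rw [we_iff hK]
  refine ⟨hF, fun i b => ?_⟩
  obtain ⟨a, rfl⟩ := h i b
  exact ⟨a, _, _, IsInv.unit (a ≫ F.onObj), by simp [E.unit_src], by simp [E.unit_tgt]⟩

/-- The fibrations which are weak equivalences are the fully faithful internal functors whose map of
objects is a `J`-epimorphism. -/
lemma fib_inf_we_iff {D E : InternalCat C} (F : D ⟶ E) :
    (fib J ⊓ we J) F ↔ FullyFaithful F ∧ LiftsFrom K F.onObj := by
  constructor
  · rintro ⟨h₁, h₂⟩
    rw [fib_iff hK] at h₁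
    rw [we_iff hK] at h₂
    refine ⟨h₂.1, fun i b => ?_⟩
    -- Essential surjectivity gives an isomorphism from b to F a. The fibration property lifts it,
    -- and the source of the lift is a strict preimage of b.
    obtain ⟨a, f, g, h, rfl, hfa⟩ := h₂.2 i b
    obtain ⟨f', g', h', -, rfl⟩ := h₁ i a f g h hfa
    exact ⟨f' ≫ D.src, by rw [Category.assoc, Category.assoc, F.onMor_src]⟩
  · rintro ⟨h₁, h₂⟩
    refine ⟨?_, we_of_fullyFaithful hK h₁ h₂⟩
    rw [fib_iff hK]
    intro i a f g h hfa
    -- A preimage of the source of `f` is chosen first; full faithfulness then lifts `f` and its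
    -- inverse between prescribed ends.
    obtain ⟨b, hb⟩ := h₂ i (f ≫ E.src)
    obtain ⟨f', hf₀, hf₁, hf⟩ := h₁.exists_lift f b a hb.symm hfa
    obtain ⟨g', hg₀, hg₁, hg⟩ := h₁.exists_lift g a b (by rw [← h.tgt, hfa]) (by rw [← h.src, hb])
    refine ⟨f', g', h₁.isInv (by rw [hf₀, hg₁]) (by rw [hf₁, hg₀]) ?_, hf₁, hf⟩
    rwa [hf, hg]

/-- Coproduct inclusions with a projective complement on objects are cofibrations. -/
lemma cof_of_isCoprod {A E : InternalCat C} {P : C} (hP : IsTopologyProjective J P) {j : A ⟶ E}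
    {inr : P ⟶ E.obj} (hc : IsCoprod j.onObj inr) : cof J j := by
  intro X Y G hG
  rw [fib_inf_we_iff hK] at hG
  refine ⟨fun {a b} sq => ?_⟩
  obtain ⟨l, h₁, h₂⟩ := exists_lift_of_fullyFaithful hc hG.1
    (fun x => hP G.onObj ((hK _).2 hG.2) x) a b sq.w
  exact ⟨⟨⟨l, h₁, h₂⟩⟩⟩

variable [HasBinaryCoproducts C] (hJ : EnoughTopologyProjectives J)

include hJ

/-- Restrict `B` along F₀ and a τ-epi map from a projective `P` to B₀. The summand A₀ carries `F`,
while `P` alone already makes the object part of `q` a `J`-epimorphism. -/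
lemma exists_cof_factorization {A B : InternalCat C} (F : A ⟶ B) :
    ∃ (E : InternalCat C) (j : A ⟶ E) (q : E ⟶ B), j ≫ q = F ∧ cof J j ∧ (fib J ⊓ we J) q := by
  obtain ⟨P, p, hP, hp⟩ := hJ B.obj
  obtain ⟨E, q, inl, inr, hq, hc, hl, hr⟩ := B.exists_fullyFaithful_of_coprod F.onObj p
  obtain ⟨j, rfl, hj⟩ := hq.exists_lift_hom F inl hl
  refine ⟨E, j, q, hj, cof_of_isCoprod hK hP hc, ?_⟩
  rw [fib_inf_we_iff hK]
  refine ⟨hq, fun i x => ?_⟩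
  obtain ⟨y, rfl⟩ := (hK _).1 hp i x
  exact ⟨y ≫ inr, by rw [Category.assoc, hr]⟩

/-- Every internal functor factors as a coproduct inclusion with projective complement on objects
which has a fully faithful retraction, followed by a fibration. -/
lemma exists_retraction_fib_factorization {A B : InternalCat C} (F : A ⟶ B) :
    ∃ (E : InternalCat C) (j : A ⟶ E) (q : E ⟶ B) (P : C) (inr : P ⟶ E.obj) (r : E ⟶ A),
      j ≫ q = F ∧ IsTopologyProjective J P ∧ IsCoprod j.onObj inr ∧
      FullyFaithful r ∧ j ≫ r = 𝟙 A ∧ fib J q := by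
  obtain ⟨P, p, hP, hp⟩ := hJ (mappingPath F)
  obtain ⟨E, r, inl, inr, hr, hc, hl, hinr⟩ :=
    A.exists_fullyFaithful_of_coprod (𝟙 A.obj) (p ≫ pullback.fst F.onObj B.isoTgt)
  obtain ⟨j, rfl, hj⟩ := hr.exists_lift_hom (𝟙 A) inl hl
  -- On `A` the family is the identity; on a point of `P` over (a, b ≅ F a) it is the isomorphism b
  -- ≅ F a itself. The conjugate of `r ≫ F` thus sends that point to b.
  obtain ⟨θ, hθl, hθr⟩ := hc.exists_desc (F.onObj ≫ B.unit)
    ((p ≫ pullback.snd F.onObj B.isoTgt) ≫ B.isoι)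
  obtain ⟨θ', hθ'l, hθ'r⟩ := hc.exists_desc (F.onObj ≫ B.unit)
    ((p ≫ pullback.snd F.onObj B.isoTgt) ≫ B.isoInv)
  have hθ : B.IsInv θ θ' := by
    apply hc.isInv
    · rw [hθl, hθ'l]
      exact IsInv.unit _
    · rw [hθr, hθ'r]
      exact B.isInv_iso.comp _
  have hθt : θ ≫ B.tgt = (r ≫ F).onObj := by
    apply hc.ext
    · rw [reassoc_of% hθl, B.unit_tgt, Category.comp_id, comp_onObj, reassoc_of% hl]
    · rw [reassoc_of% hθr, comp_onObj, reassoc_of% hinr]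
      simpa only [Category.assoc] using mappingPath_condition F p
  refine ⟨E, j, conj (r ≫ F) hθ hθt, P, inr, r, ?_, hP, hc, hr, hj, ?_⟩
  · rw [comp_conj, reassoc_of% hj]
    rw [hθl, comp_onObj, Category.assoc, reassoc_of% hl]
  rw [fib_iff hK]
  intro i e f g hfg he
  rw [conj_onObj, ← Category.assoc] at he
  have hθe := hθ.comp e
  -- the composite of `f` and `θ`, as a generalized element of the mapping path object
  obtain ⟨y, hy⟩ := (hK _).1 hp i ((hfg.mul hθe he).path (F := F) (a := e ≫ r.onObj)
    (by rw [mul_tgt, Category.assoc, Category.assoc, hθt, comp_onObj]))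
  have hy₀ : (y ≫ inr) ≫ r.onObj = e ≫ r.onObj := by
    rw [Category.assoc, hinr, reassoc_of% hy, IsInv.path_fst]
  have hyθ : (y ≫ inr) ≫ θ = B.mul f (e ≫ θ) he := by
    rw [Category.assoc, hθr, Category.assoc, reassoc_of% hy, ← Category.assoc, IsInv.path_snd,
      IsInv.lift_isoι]
  -- The points `y ≫ inr` and `e` have the same image under `r`, so the identity there lifts to an
  -- isomorphism `x` between them. The conjugate sends `x` to θ at `y ≫ inr` followed by θ' at `e`,
  -- which is `f` followed by θ and θ' at `e`, hence `f`.
  obtain ⟨x, hx₀, hx₁, hx⟩ := hr.exists_lift ((e ≫ r.onObj) ≫ A.unit) (y ≫ inr) e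
    (by rw [hy₀]; simp [A.unit_src]) (by simp [A.unit_tgt])
  obtain ⟨x', hx'₀, hx'₁, hx'⟩ := hr.exists_lift ((e ≫ r.onObj) ≫ A.unit) e (y ≫ inr)
    (by simp [A.unit_src]) (by rw [hy₀]; simp [A.unit_tgt])
  refine ⟨x, x', hr.isInv (by rw [hx₀, hx'₁]) (by rw [hx₁, hx'₀]) ?_, hx₁, ?_⟩
  · rw [hx, hx']
    exact IsInv.unit _
  · have h₁ : x ≫ E.src ≫ θ = B.mul f (e ≫ θ) he := by rw [reassoc_of% hx₀, ← hyθ, Category.assoc]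
    have h₂ : x ≫ r.onMor ≫ F.onMor = (e ≫ r.onObj ≫ F.onObj) ≫ B.unit := by
      rw [reassoc_of% hx, F.unit_onMor]
      simp only [Category.assoc]
    have h₃ : x ≫ E.tgt ≫ θ' = e ≫ θ' := by rw [reassoc_of% hx₁]
    have h₄ := B.unit_mul_of (a := e ≫ r.onObj ≫ F.onObj) (f := e ≫ θ')
      (by rw [Category.assoc, ← hθ.tgt, hθt, comp_onObj])
    simp only [conj_onMor, comp_mul, comp_onMor', h₁, h₂, h₃, h₄]
    exact hθe.mul_mul_inv he

end Model

end InternalCat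

/-! ### Stability under retracts and the model structure. -/

namespace InternalCat

variable {C : Type u} [Category.{v} C] [HasFiniteLimits C]

lemma fullyFaithful_of_forall {D E : InternalCat C} {F : D ⟶ E}
    (hF : ∀ {X : C} (f : X ⟶ E.mor) (a b : X ⟶ D.obj), f ≫ E.src = a ≫ F.onObj →
      f ≫ E.tgt = b ≫ F.onObj → ∃ g : X ⟶ D.mor, g ≫ D.src = a ∧ g ≫ D.tgt = b ∧ g ≫ F.onMor = f)
    (hF' : ∀ {X : C} {f g : X ⟶ D.mor}, f ≫ D.src = g ≫ D.src → f ≫ D.tgt = g ≫ D.tgt →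
      f ≫ F.onMor = g ≫ F.onMor → f = g) : FullyFaithful F := by
  have w : F.onMor ≫ prod.lift E.src E.tgt =
      prod.lift D.src D.tgt ≫ prod.map F.onObj F.onObj := by
    rw [prod.comp_lift, prod.lift_map, F.onMor_src, F.onMor_tgt]
  have H (s : PullbackCone (prod.lift E.src E.tgt) (prod.map F.onObj F.onObj)) :
      ∃ g : s.pt ⟶ D.mor, g ≫ D.src = s.snd ≫ prod.fst ∧ g ≫ D.tgt = s.snd ≫ prod.snd ∧
        g ≫ F.onMor = s.fst := by
    have hs := s.condition
    refine hF _ _ _ ?_ ?_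
    · simpa [prod.lift_fst] using congrArg (· ≫ prod.fst) hs
    · simpa [prod.lift_snd] using congrArg (· ≫ prod.snd) hs
  choose g h₀ h₁ h using H
  refine ⟨⟨w⟩, ⟨PullbackCone.IsLimit.mk w g h (fun s => ?_) fun s m hm hm' => ?_⟩⟩
  · apply Limits.prod.hom_ext
    · rw [Category.assoc, prod.lift_fst, h₀]
    · rw [Category.assoc, prod.lift_snd, h₁]
  · refine hF' ?_ ?_ (hm.trans (h s).symm)
    · rw [h₀, ← hm', Category.assoc, prod.lift_fst]
    · rw [h₁, ← hm', Category.assoc, prod.lift_snd]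

section Retract

variable {A B D E : InternalCat C} {F : A ⟶ B} {G : D ⟶ E} (h : RetractArrow F G)

include h

lemma exists_retract_data : ∃ (i : A ⟶ D) (i' : B ⟶ E) (r : D ⟶ A) (r' : E ⟶ B),
    i ≫ G = F ≫ i' ∧ r ≫ F = G ≫ r' ∧ i ≫ r = 𝟙 A ∧ i' ≫ r' = 𝟙 B :=
  ⟨h.i.left, h.i.right, h.r.left, h.r.right, h.i_w, h.r_w, h.retract_left, h.retract_right⟩

/-- Include the data into `G`, lift there and retract. Uniqueness also passes to `F`, because the
inclusion of morphisms has a left inverse. -/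
lemma FullyFaithful.of_retract (hG : FullyFaithful G) : FullyFaithful F := by
  obtain ⟨i, i', r, r', i_w, r_w, hl, hr⟩ := exists_retract_data h
  have i_w₀ := congrArg Hom.onObj i_w
  have i_w₁ := congrArg Hom.onMor i_w
  have r_w₁ := congrArg Hom.onMor r_w
  have hl₀ := congrArg Hom.onObj hl
  have hl₁ := congrArg Hom.onMor hl
  have hr₁ := congrArg Hom.onMor hr
  simp only [comp_onObj, comp_onMor', id_onObj, id_onMor] at i_w₀ i_w₁ r_w₁ hl₀ hl₁ hr₁
  apply fullyFaithful_of_forall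
  · intro X f a b ha hb
    obtain ⟨g, h₀, h₁, h₂⟩ := hG.exists_lift (f ≫ i'.onMor) (a ≫ i.onObj) (b ≫ i.onObj)
      (by rw [Category.assoc, i'.onMor_src, reassoc_of% ha, Category.assoc, i_w₀])
      (by rw [Category.assoc, i'.onMor_tgt, reassoc_of% hb, Category.assoc, i_w₀])
    refine ⟨g ≫ r.onMor, ?_, ?_, ?_⟩
    · rw [Category.assoc, r.onMor_src, reassoc_of% h₀, hl₀, Category.comp_id]
    · rw [Category.assoc, r.onMor_tgt, reassoc_of% h₁, hl₀, Category.comp_id]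
    · rw [Category.assoc, r_w₁, reassoc_of% h₂, hr₁, Category.comp_id]
  · intro X f g h₀ h₁ h₂
    have : f ≫ i.onMor = g ≫ i.onMor := by
      refine hG.ext ?_ ?_ ?_
      · simp only [Category.assoc, i.onMor_src, reassoc_of% h₀]
      · simp only [Category.assoc, i.onMor_tgt, reassoc_of% h₁]
      · simp only [Category.assoc, i_w₁, reassoc_of% h₂]
    have := congrArg (· ≫ r.onMor) this
    simpa only [Category.assoc, hl₁, Category.comp_id] using this

variable {ι : Type w} {K : ι → C} {J : GrothendieckTopology C}
  (hK : ∀ {E B : C} (p : E ⟶ B), IsTopologyEpi J p ↔ LiftsFrom K p)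

include hK

lemma we_of_retract (hG : we J G) : we J F := by
  rw [we_iff hK] at hG ⊢
  refine ⟨hG.1.of_retract h, fun k b => ?_⟩
  obtain ⟨i, i', r, r', -, r_w, -, hr⟩ := exists_retract_data h
  have r_w₀ := congrArg Hom.onObj r_w
  have hr₀ := congrArg Hom.onObj hr
  simp only [comp_onObj, id_onObj] at r_w₀ hr₀
  obtain ⟨a, f, g, hfg, h₀, h₁⟩ := hG.2 k (b ≫ i'.onObj)
  refine ⟨a ≫ r.onObj, _, _, hfg.map r', ?_, ?_⟩
  · rw [Category.assoc, r'.onMor_src, reassoc_of% h₀, hr₀, Category.comp_id]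
  · rw [Category.assoc, r'.onMor_tgt, reassoc_of% h₁, Category.assoc, r_w₀]

lemma fib_of_retract (hG : fib J G) : fib J F := by
  rw [fib_iff hK] at hG ⊢
  intro k a f g hfg hfa
  obtain ⟨i, i', r, r', i_w, r_w, hl, hr⟩ := exists_retract_data h
  have i_w₀ := congrArg Hom.onObj i_w
  have r_w₁ := congrArg Hom.onMor r_w
  have hl₀ := congrArg Hom.onObj hl
  have hr₁ := congrArg Hom.onMor hr
  simp only [comp_onObj, comp_onMor', id_onObj, id_onMor] at i_w₀ r_w₁ hl₀ hr₁
  obtain ⟨f', g', hfg', h₀, h₁⟩ := hG k (a ≫ i.onObj) _ _ (hfg.map i')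
    (by rw [Category.assoc, i'.onMor_tgt, reassoc_of% hfa, Category.assoc, i_w₀])
  refine ⟨_, _, hfg'.map r, ?_, ?_⟩
  · rw [Category.assoc, r.onMor_tgt, reassoc_of% h₀, hl₀, Category.comp_id]
  · rw [Category.assoc, r_w₁, reassoc_of% h₁, hr₁, Category.comp_id]

end Retract

open HomotopicalAlgebra in
/-- The model structure determined by a topology whose epimorphisms are detected by a family of
objects, when there are enough projectives. -/
lemma exists_modelCategory [HasFiniteLimits (InternalCat C)] [HasFiniteColimits (InternalCat C)]
    [HasBinaryCoproducts C] {ι : Type w} {K : ι → C} {J : GrothendieckTopology C}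
    (hK : ∀ {E B : C} (p : E ⟶ B), IsTopologyEpi J p ↔ LiftsFrom K p)
    (hJ : EnoughTopologyProjectives J) [h₂ : (we (C := C) J).HasTwoOutOfThreeProperty] :
    ∃ _ : ModelCategory (InternalCat C), weakEquivalences (InternalCat C) = we J ∧
      fibrations (InternalCat C) = fib J ∧ cofibrations (InternalCat C) = cof J := by
  have fac {A B : InternalCat C} (F : A ⟶ B) : ∃ (E : InternalCat C) (j : A ⟶ E) (q : E ⟶ B),
      j ≫ q = F ∧ cof J j ∧ we J j ∧ fib J q ∧
        ∀ {X Y : InternalCat C} (G : X ⟶ Y), fib J G → HasLiftingProperty j G := by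
    obtain ⟨E, j, q, P, inr, r, hjq, hP, hc, hr, hjr, hq⟩ :=
      exists_retraction_fib_factorization hK hJ F
    refine ⟨E, j, q, hjq, cof_of_isCoprod hK hP hc, ?_, hq, ?_⟩
    -- The retraction is fully faithful and has the section `j` on objects, so it is a weak
    -- equivalence; two-out-of-three for `j ≫ r = 𝟙 A` then gives `j`.
    · have hr' : we J r := by
        refine we_of_fullyFaithful hK hr fun i x => ⟨x ≫ j.onObj, ?_⟩
        rw [Category.assoc, ← comp_onObj, hjr, id_onObj, Category.comp_id]
      have hid : we J (𝟙 A) :=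
        we_of_fullyFaithful hK (fullyFaithful_id A) fun i x => ⟨x, Category.comp_id x⟩
      exact (we J).of_postcomp j r hr' (hjr ▸ hid)
    · intro X Y G hG
      refine ⟨fun {a b} sq => ?_⟩
      obtain ⟨l, h₁, h₂⟩ := exists_lift_of_retraction hc hr hjr
        (fun x => hP (mappingPathLift G) hG x) a b sq.w
      exact ⟨⟨⟨l, h₁, h₂⟩⟩⟩
  refine ⟨{ categoryWithWeakEquivalences := ⟨we J⟩, categoryWithFibrations := ⟨fib J⟩,
            categoryWithCofibrations := ⟨cof J⟩, cm2 := ?_, cm3a := ?_, cm3b := ?_,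
            cm3c := ?_, cm4a := ?_, cm4b := ?_, cm5a := ?_, cm5b := ?_ }, rfl, rfl, rfl⟩
  · exact h₂
  · exact ⟨fun h hG => we_of_retract h hK hG⟩
  · exact ⟨fun h hG => fib_of_retract h hK hG⟩
  · exact inferInstanceAs (fib J ⊓ we J).llp.IsStableUnderRetracts
  · intro A B X Y i p hi hi' hp
    -- Retract argument: by two-out-of-three `q` is a trivial fibration, so the cofibration `i`
    -- lifts against it. Hence `i` is a retract of `j` and inherits its lifting property against
    -- fibrations.
    obtain ⟨E, j, q, hjq, -, hj, hq, hlift⟩ := fac i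
    have hq' : we J q := (we J).of_precomp j q hj (hjq ▸ hi'.mem)
    have : HasLiftingProperty i q := hi.mem q ⟨hq, hq'⟩
    have := hlift p hp.mem
    exact (RetractArrow.ofLeftLiftingProperty hjq).leftLiftingProperty p
  · intro A B X Y i p hi hp hp'
    exact hi.mem p ⟨hp.mem, hp'.mem⟩
  · refine ⟨fun F => ?_⟩
    obtain ⟨E, j, q, hjq, hj, hj', hq, -⟩ := fac F
    exact ⟨{ Z := E, i := j, p := q, fac := hjq, hi := ⟨hj, hj'⟩, hp := hq }⟩
  · refine ⟨fun F => ?_⟩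
    obtain ⟨E, j, q, hjq, hj, hq⟩ := exists_cof_factorization hK hJ F
    exact ⟨{ Z := E, i := j, p := q, fac := hjq, hi := hj, hp := hq }⟩

end InternalCat

/-! ### The simplicially surjective topology -/

lemma liftsFrom_ordinalCat_iff {A B : Cat.{u, u}} (F : A ⟶ B) :
    LiftsFrom ordinalCat.{u} F ↔ SimpliciallySurjective F :=
  (simpliciallySurjective_iff F).symm

/-- The `τ`-epimorphisms are the simplicially surjective functors. -/
lemma isTopologyEpi_iff_liftsFrom {E B : Cat.{u, u}} (p : E ⟶ B) :
    IsTopologyEpi simpliciallySurjectiveTopology.{u} p ↔ LiftsFrom ordinalCat.{u} p := by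
  rw [IsTopologyEpi, ← Sheaf.isLocallySurjective_iff_epi',
    Presheaf.isLocallySurjective_presheafToSheaf_map_iff]
  constructor
  · intro h k x
    -- Local surjectivity at the identity of `B` yields a cover `F` of `B` which factors through
    -- `p`. Strings lift along `F`, hence along `p`.
    have := h.imageSieve_mem (U := B) (ULift.up (𝟙 B))
    rw [simpliciallySurjectiveTopology, Pretopology.mem_toGrothendieck] at this
    obtain ⟨_, ⟨Y, F, hF, rfl⟩, hle⟩ := this
    obtain ⟨⟨t⟩, ht⟩ := hle _ _ (Presieve.singleton_self F)
    obtain ⟨y, hy⟩ := (simpliciallySurjective_iff F).1 hF k x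
    have ht' : t ≫ p = F := by
      have := congrArg ULift.down ht
      exact this.trans (Category.comp_id F)
    exact ⟨y ≫ t, by rw [Category.assoc, ht', hy]⟩
  · intro h
    refine ⟨fun {U} s => ?_⟩
    obtain ⟨s⟩ := s
    rw [simpliciallySurjectiveTopology, Pretopology.mem_toGrothendieck]
    -- The pullback of `p` along `s` inherits the lifting of strings, so it is itself a cover, and
    -- `s` lifts tautologically over it.
    refine ⟨_, ⟨_, pullback.snd p s, ?_, rfl⟩, ?_⟩
    · rw [simpliciallySurjective_iff]
      intro k x
      obtain ⟨y, hy⟩ := h k (x ≫ s)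
      exact ⟨pullback.lift y x hy, pullback.lift_snd _ _ _⟩
    · rintro _ _ ⟨⟩
      exact ⟨ULift.up (pullback.fst p s), congrArg ULift.up (pullback.condition (f := p) (g := s))⟩

/-- Coproducts of the categories `[k]` are `τ`-projective. -/
lemma isTopologyProjective_sigma {ι : Type u} (k : ι → ℕ) :
    IsTopologyProjective simpliciallySurjectiveTopology.{u} (∐ fun i => ordinalCat.{u} (k i)) := by
  intro Q R G hG H
  rw [isTopologyEpi_iff_liftsFrom] at hG
  choose y hy using fun i => hG (k i) (Sigma.ι (fun i => ordinalCat.{u} (k i)) i ≫ H)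
  refine ⟨Sigma.desc y, Sigma.hom_ext _ _ fun i => ?_⟩
  rw [Sigma.ι_desc_assoc, hy]

/-- Take one copy of [k] for each functor [k] → X, over all k: every such functor lifts to its own
coproduct inclusion. The `ULift` puts the index type in the universe of the coproducts. -/
lemma enoughTopologyProjectives_simpliciallySurjective :
    EnoughTopologyProjectives simpliciallySurjectiveTopology.{u} := by
  intro X
  let k : (Σ k : ULift.{u} ℕ, ordinalCat.{u} k.down ⟶ X) → ℕ := fun i => i.1.down
  refine ⟨_, Sigma.desc fun i : Σ k : ULift.{u} ℕ, ordinalCat.{u} k.down ⟶ X => i.2,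
    isTopologyProjective_sigma k, ?_⟩
  rw [isTopologyEpi_iff_liftsFrom]
  intro n x
  exact ⟨Sigma.ι (fun i => ordinalCat.{u} (k i)) ⟨⟨n⟩, x⟩, Sigma.ι_desc _ _⟩

/-- A functor is an isomorphism of categories if composition with it is bijective on functors out of
the categories `[k]`. -/
lemma isIso_of_bijective_ordinalCat {A B : Cat.{u, u}} (F : A ⟶ B)
    (h : LiftsFrom ordinalCat.{u} F)
    (h' : ∀ (k : ℕ) (x y : ordinalCat.{u} k ⟶ A), x ≫ F = y ≫ F → x = y) : IsIso F := by
  -- The two hypotheses say that the nerve of `F` is bijective in each degree, and the nerve functor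
  -- reflects isomorphisms.
  have : IsIso (nerveFunctor.{u, u}.map F) := by
    rw [NatTrans.isIso_iff_isIso_app]
    intro n
    obtain ⟨n⟩ := n
    induction n using SimplexCategory.rec with | _ k
    rw [isIso_iff_bijective]
    refine ⟨fun x y hxy => ?_, (liftsFrom_ordinalCat_iff F).1 h k⟩
    have hup : Monotone (ULift.up.{u} : Fin (k + 1) → ULift.{u} (Fin (k + 1))) :=
      fun _ _ h => h
    have hdown : Monotone (ULift.down : ULift.{u} (Fin (k + 1)) → Fin (k + 1)) := fun _ _ h => h
    have hxy : (x : Fin (k + 1) ⥤ A) ⋙ F.toFunctor = (y : Fin (k + 1) ⥤ A) ⋙ F.toFunctor := hxy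
    have := h' k (hdown.functor ⋙ (x : Fin (k + 1) ⥤ A)).toCatHom
      (hdown.functor ⋙ (y : Fin (k + 1) ⥤ A)).toCatHom
      (Cat.Hom.ext (congrArg (fun G => hdown.functor ⋙ G) hxy))
    exact congrArg (fun G => hup.functor ⋙ G) (congrArg Cat.Hom.toFunctor this)
  exact isIso_of_reflects_iso F nerveFunctor.{u, u}

/-! ### τ-equivalences and the vertical nerve. -/

namespace DblCat

open InternalCat

variable {D E : DblCat.{u}}

/-- Full faithfulness of double functors is detected by the strings of squares. -/
lemma fullyFaithful_of_ordinalCat {F : D ⟶ E}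
    (hF : ∀ {k : ℕ} (f : ordinalCat.{u} k ⟶ E.mor) (a b : ordinalCat.{u} k ⟶ D.obj),
      f ≫ E.src = a ≫ F.onObj → f ≫ E.tgt = b ≫ F.onObj →
        ∃ g : ordinalCat.{u} k ⟶ D.mor, g ≫ D.src = a ∧ g ≫ D.tgt = b ∧ g ≫ F.onMor = f)
    (hF' : ∀ {k : ℕ} {f g : ordinalCat.{u} k ⟶ D.mor}, f ≫ D.src = g ≫ D.src →
      f ≫ D.tgt = g ≫ D.tgt → f ≫ F.onMor = g ≫ F.onMor → f = g) : FullyFaithful F := by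
  have w : F.onMor ≫ prod.lift E.src E.tgt =
      prod.lift D.src D.tgt ≫ prod.map F.onObj F.onObj := by
    rw [prod.comp_lift, prod.lift_map, F.onMor_src, F.onMor_tgt]
  have hfst : pullback.lift F.onMor (prod.lift D.src D.tgt) w ≫ pullback.fst _ _ = F.onMor :=
    pullback.lift_fst _ _ _
  have hsnd : pullback.lift F.onMor (prod.lift D.src D.tgt) w ≫ pullback.snd _ _ =
      prod.lift D.src D.tgt := pullback.lift_snd _ _ _
  -- The map `c` compares `D.mor` with the canonical pullback, and only its two projections matter.
  -- The hypotheses say that it is bijective on strings.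
  generalize pullback.lift F.onMor (prod.lift D.src D.tgt) w = c at hfst hsnd
  have : IsIso c := by
    apply isIso_of_bijective_ordinalCat
    · intro k x
      obtain ⟨g, h₀, h₁, h⟩ := hF (x ≫ pullback.fst _ _) (x ≫ pullback.snd _ _ ≫ prod.fst)
        (x ≫ pullback.snd _ _ ≫ prod.snd)
        (by simp only [Category.assoc, restrictMor_src])
        (by simp only [Category.assoc, restrictMor_tgt])
      refine ⟨g, ?_⟩
      apply pullback.hom_ext
      · rw [Category.assoc, hfst, h]
      · rw [Category.assoc, hsnd]
        apply Limits.prod.hom_ext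
        · simp only [Category.assoc, prod.lift_fst, h₀]
        · simp only [Category.assoc, prod.lift_snd, h₁]
    · intro k x y hxy
      have e := congrArg (· ≫ pullback.snd _ _) hxy
      simp only [Category.assoc, hsnd] at e
      refine hF' ?_ ?_ ?_
      · simpa [prod.lift_fst] using congrArg (· ≫ prod.fst) e
      · simpa [prod.lift_snd] using congrArg (· ≫ prod.snd) e
      · simpa only [Category.assoc, hfst] using congrArg (· ≫ pullback.fst _ _) hxy
  exact IsPullback.of_iso_pullback ⟨w⟩ (asIso c) hfst hsnd

/-- Isomorphisms in the vertical nerve are given by mutually inverse strings of squares. -/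
lemma VerticalNerve.isInv {k : ℕ} {a b : D.VerticalNerve k} (e : a ≅ b) :
    D.IsInv e.hom.1 e.inv.1 where
  src := e.hom.2.1.trans e.inv.2.2.symm
  tgt := e.hom.2.2.trans e.inv.2.1.symm
  mul_inv := by
    refine (congrArg Subtype.val e.hom_inv_id).trans ?_
    rw [← Category.assoc, e.hom.2.1]
    rfl
  inv_mul := by
    refine (congrArg Subtype.val e.inv_hom_id).trans ?_
    rw [← Category.assoc, e.hom.2.2]
    rfl

/-- The isomorphism in the vertical nerve given by mutually inverse strings of squares. -/
noncomputable def VerticalNerve.isoOfIsInv {k : ℕ} {a b : D.VerticalNerve k}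
    {f g : ordinalCat.{u} k ⟶ D.mor} (h : D.IsInv f g) (ha : f ≫ D.src = a.pt)
    (hb : f ≫ D.tgt = b.pt) : a ≅ b where
  hom := ⟨f, ha, hb⟩
  inv := ⟨g, by rw [← h.tgt, hb], by rw [← h.src, ha]⟩
  hom_inv_id := Subtype.ext (h.mul_inv.trans (by rw [← Category.assoc, ha]; rfl))
  inv_hom_id := Subtype.ext (h.inv_mul.trans (by rw [← Category.assoc, hb]; rfl))

/-- The `τ`-equivalences are the double functors which induce levelwise equivalences of vertical
nerves. -/
lemma we_iff_isEquivalence (F : D ⟶ E) :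
    we simpliciallySurjectiveTopology.{u} F ↔
      ∀ k : ℕ, (verticalNerveMap F k).IsEquivalence := by
  rw [we_iff isTopologyEpi_iff_liftsFrom]
  constructor
  · rintro ⟨h₁, h₂⟩ k
    -- Full faithfulness is evaluated at the generalized elements defined on [k]. Essential
    -- surjectivity at level k is word for word the lifting of strings up to an invertible string of
    -- squares.
    exact
      { faithful := ⟨fun {a b f g} hfg => Subtype.ext
          (h₁.ext (f.2.1.trans g.2.1.symm) (f.2.2.trans g.2.2.symm) (congrArg Subtype.val hfg))⟩
        full := ⟨fun {a b} f => by
          obtain ⟨g, ha, hb, hg⟩ := h₁.exists_lift f.1 a.pt b.pt f.2.1 f.2.2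
          exact ⟨⟨g, ha, hb⟩, Subtype.ext hg⟩⟩
        essSurj := ⟨fun b => by
          obtain ⟨a, f, g, hfg, h₀, h⟩ := h₂ k b.pt
          exact ⟨⟨a⟩, ⟨(VerticalNerve.isoOfIsInv hfg h₀ h).symm⟩⟩⟩ }
  · intro h
    refine ⟨fullyFaithful_of_ordinalCat ?_ ?_, fun k b => ?_⟩
    · intro k f a b ha hb
      have := h k
      obtain ⟨g, hg⟩ := Functor.map_surjective (verticalNerveMap F k)
        (X := VerticalNerve.mk a) (Y := VerticalNerve.mk b) ⟨f, ha, hb⟩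
      exact ⟨g.1, g.2.1, g.2.2, congrArg Subtype.val hg⟩
    · intro k f g h₀ h₁ hfg
      have := h k
      have := (verticalNerveMap F k).map_injective (X := ⟨g ≫ D.src⟩) (Y := ⟨g ≫ D.tgt⟩)
        (a₁ := ⟨f, h₀, h₁⟩) (a₂ := ⟨g, rfl, rfl⟩) (Subtype.ext hfg)
      exact congrArg Subtype.val this
    · have := h k
      let e := (verticalNerveMap F k).objObjPreimageIso ⟨b⟩
      exact ⟨((verticalNerveMap F k).objPreimage ⟨b⟩).pt, _, _, VerticalNerve.isInv e.symm,
        e.symm.hom.2.1, e.symm.hom.2.2⟩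

/-- The vertical nerve of a composite is the composite of the vertical nerves, so the property is
inherited from equivalences of categories at each level. -/
instance we_hasTwoOutOfThreeProperty :
    (we (C := Cat.{u, u}) simpliciallySurjectiveTopology.{u}).HasTwoOutOfThreeProperty where
  comp_mem F G hF hG := by
    rw [we_iff_isEquivalence] at hF hG ⊢
    intro k
    have := hF k
    have := hG k
    exact inferInstanceAs (verticalNerveMap F k ⋙ verticalNerveMap G k).IsEquivalence
  of_postcomp F G hG hFG := by
    rw [we_iff_isEquivalence] at hG hFG ⊢
    intro k
    have := hG k
    have : (verticalNerveMap F k ⋙ verticalNerveMap G k).IsEquivalence := hFG k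
    exact Functor.isEquivalence_of_comp_right _ (verticalNerveMap G k)
  of_precomp F G hF hFG := by
    rw [we_iff_isEquivalence] at hF hFG ⊢
    intro k
    have := hF k
    have : (verticalNerveMap F k ⋙ verticalNerveMap G k).IsEquivalence := hFG k
    exact Functor.isEquivalence_of_comp_left (verticalNerveMap F k) _

end DblCat

namespace InternalCat

variable {C : Type u} [Category.{v} C] [HasFiniteLimits C]

/-! ### Limits of internal categories -/

/-- The functor which sends an internal category to its object of objects. -/
@[simps]
def objFunctor : InternalCat C ⥤ C where
  obj D := D.obj
  map F := F.onObj

/-- The functor which sends an internal category to its object of morphisms. -/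
@[simps]
def morFunctor : InternalCat C ⥤ C where
  obj D := D.mor
  map F := F.onMor

section Limits

variable {I : Type*} [Category* I] [HasLimitsOfShape I C] (F : I ⥤ InternalCat C)

/-- The source maps, as a map between limits. -/
noncomputable def limSrc : limit (F ⋙ morFunctor) ⟶ limit (F ⋙ objFunctor) :=
  limMap { app := fun i => (F.obj i).src, naturality := fun _ _ f => (F.map f).onMor_src }

/-- The target maps, as a map between limits. -/
noncomputable def limTgt : limit (F ⋙ morFunctor) ⟶ limit (F ⋙ objFunctor) :=
  limMap { app := fun i => (F.obj i).tgt, naturality := fun _ _ f => (F.map f).onMor_tgt }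

/-- The units, as a map between limits. -/
noncomputable def limUnit : limit (F ⋙ objFunctor) ⟶ limit (F ⋙ morFunctor) :=
  limMap { app := fun i => (F.obj i).unit, naturality := fun _ _ f => (F.map f).unit_onMor.symm }

/-- The projection on the object of objects. -/
noncomputable def limπ₀ (i : I) : limit (F ⋙ objFunctor) ⟶ (F.obj i).obj :=
  limit.π (F ⋙ objFunctor) i

/-- The projection on the object of morphisms. -/
noncomputable def limπ₁ (i : I) : limit (F ⋙ morFunctor) ⟶ (F.obj i).mor :=
  limit.π (F ⋙ morFunctor) i

lemma limSrc_π (i : I) : limSrc F ≫ limπ₀ F i = limπ₁ F i ≫ (F.obj i).src :=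
  limMap_π _ _

lemma limTgt_π (i : I) : limTgt F ≫ limπ₀ F i = limπ₁ F i ≫ (F.obj i).tgt :=
  limMap_π _ _

lemma limUnit_π (i : I) : limUnit F ≫ limπ₁ F i = limπ₀ F i ≫ (F.obj i).unit :=
  limMap_π _ _

lemma limπ₀_w {i k : I} (f : i ⟶ k) : limπ₀ F i ≫ (F.map f).onObj = limπ₀ F k :=
  limit.w (F ⋙ objFunctor) f

lemma limπ₁_w {i k : I} (f : i ⟶ k) : limπ₁ F i ≫ (F.map f).onMor = limπ₁ F k :=
  limit.w (F ⋙ morFunctor) f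

variable {F} in
lemma lim₀_ext {X : C} {f g : X ⟶ limit (F ⋙ objFunctor)}
    (h : ∀ i, f ≫ limπ₀ F i = g ≫ limπ₀ F i) : f = g := limit.hom_ext h

variable {F} in
lemma lim₁_ext {X : C} {f g : X ⟶ limit (F ⋙ morFunctor)}
    (h : ∀ i, f ≫ limπ₁ F i = g ≫ limπ₁ F i) : f = g := limit.hom_ext h

lemma limComp_aux (i : I) :
    (pullback.fst (limTgt F) (limSrc F) ≫ limπ₁ F i) ≫ (F.obj i).tgt =
      (pullback.snd (limTgt F) (limSrc F) ≫ limπ₁ F i) ≫ (F.obj i).src := by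
  rw [Category.assoc, Category.assoc, ← limSrc_π, ← limTgt_π, pullback.condition_assoc]

/-- The compositions, as a map to a limit. -/
noncomputable def limComp : pullback (limTgt F) (limSrc F) ⟶ limit (F ⋙ morFunctor) :=
  limit.lift (F ⋙ morFunctor)
    { pt := pullback (limTgt F) (limSrc F)
      π :=
        { app := fun i => (F.obj i).mul (pullback.fst (limTgt F) (limSrc F) ≫ limπ₁ F i)
            (pullback.snd (limTgt F) (limSrc F) ≫ limπ₁ F i) (limComp_aux F i)
          naturality := fun i k f => by
            change 𝟙 _ ≫ (F.obj k).mul _ _ _ = (F.obj i).mul _ _ _ ≫ (F.map f).onMor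
            rw [Category.id_comp, Hom.mul_onMor]
            simp only [Category.assoc, limπ₁_w] } }

lemma limComp_π (i : I) : limComp F ≫ limπ₁ F i =
    (F.obj i).mul (pullback.fst (limTgt F) (limSrc F) ≫ limπ₁ F i)
      (pullback.snd (limTgt F) (limSrc F) ≫ limπ₁ F i) (limComp_aux F i) :=
  limit.lift_π _ _

/-- The limit of a diagram of internal categories, as a detected graph. -/
noncomputable def limGraph : DetectedGraph C where
  obj := limit (F ⋙ objFunctor)
  mor := limit (F ⋙ morFunctor)
  src := limSrc F
  tgt := limTgt F
  unit := limUnit F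
  comp := limComp F
  ι := I
  cat := F.obj
  onObj := limπ₀ F
  onMor := limπ₁ F
  onMor_src i := (limSrc_π F i).symm
  onMor_tgt i := (limTgt_π F i).symm
  unit_src := lim₀_ext fun i => by
    rw [Category.assoc, limSrc_π, reassoc_of% limUnit_π F i, (F.obj i).unit_src, Category.comp_id,
      Category.id_comp]
  unit_tgt := lim₀_ext fun i => by
    rw [Category.assoc, limTgt_π, reassoc_of% limUnit_π F i, (F.obj i).unit_tgt, Category.comp_id,
      Category.id_comp]
  unit_onMor := limUnit_π F
  comp_src := lim₀_ext fun i => by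
    simp only [Category.assoc, limSrc_π, reassoc_of% limComp_π F i, mul_src]
  comp_tgt := lim₀_ext fun i => by
    simp only [Category.assoc, limTgt_π, reassoc_of% limComp_π F i, mul_tgt]
  comp_onMor := limComp_π F
  ext _ _ h := lim₁_ext h

/-- The limit cone of a diagram of internal categories. -/
noncomputable def limCone : Cone F where
  pt := (limGraph F).toInternalCat
  π :=
    { app := fun i => (limGraph F).π i
      naturality := fun i k f => by
        refine (Category.id_comp _).trans (hom_ext ?_ ?_)
        · exact (limπ₀_w F f).symm
        · exact (limπ₁_w F f).symm }

/-- The map to the limit of the objects of objects. -/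
noncomputable def limLift₀ (s : Cone F) : s.pt.obj ⟶ limit (F ⋙ objFunctor) :=
  limit.lift (F ⋙ objFunctor) (objFunctor.mapCone s)

/-- The map to the limit of the objects of morphisms. -/
noncomputable def limLift₁ (s : Cone F) : s.pt.mor ⟶ limit (F ⋙ morFunctor) :=
  limit.lift (F ⋙ morFunctor) (morFunctor.mapCone s)

lemma limLift₀_π (s : Cone F) (i : I) :
    limLift₀ F s ≫ limπ₀ F i = (s.π.app i).onObj :=
  limit.lift_π _ _

lemma limLift₁_π (s : Cone F) (i : I) :
    limLift₁ F s ≫ limπ₁ F i = (s.π.app i).onMor :=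
  limit.lift_π _ _

lemma limLift_src (s : Cone F) : limLift₁ F s ≫ limSrc F = s.pt.src ≫ limLift₀ F s :=
  lim₀_ext fun i => by
    rw [Category.assoc, limSrc_π, reassoc_of% limLift₁_π F s i, Category.assoc, limLift₀_π]
    exact (s.π.app i).onMor_src

lemma limLift_tgt (s : Cone F) : limLift₁ F s ≫ limTgt F = s.pt.tgt ≫ limLift₀ F s :=
  lim₀_ext fun i => by
    rw [Category.assoc, limTgt_π, reassoc_of% limLift₁_π F s i, Category.assoc, limLift₀_π]
    exact (s.π.app i).onMor_tgt

/-- The cone `limCone` is a limit cone. -/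
noncomputable def limConeIsLimit : IsLimit (limCone F) where
  lift s := (limGraph F).lift (A := s.pt) (fun i => s.π.app i) (limLift₀ F s) (limLift₁ F s)
    (limLift_src F s) (limLift_tgt F s)
    (limLift₀_π F s) (limLift₁_π F s)
  fac s i := hom_ext (limLift₀_π F s i) (limLift₁_π F s i)
  uniq s _ hm := hom_ext
    (lim₀_ext fun i => (congrArg Hom.onObj (hm i)).trans (limLift₀_π F s i).symm)
    (lim₁_ext fun i => (congrArg Hom.onMor (hm i)).trans (limLift₁_π F s i).symm)

instance : HasLimitsOfShape I (InternalCat C) where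
  has_limit F := ⟨⟨limCone F, limConeIsLimit F⟩⟩

end Limits

instance [HasLimits C] : HasLimits (InternalCat C) where
  has_limits_of_shape _ _ := inferInstance

/-! ### Internal subcategories -/

section Sub

variable (D : InternalCat C) {O M : C} (i₀ : O ⟶ D.obj) (i₁ : M ⟶ D.mor) [Mono i₀] [Mono i₁]

/-- Subobjects of the objects of objects and of morphisms which are closed under the operations of
an internal category carry an internal category. -/
lemma exists_subcategory (hs : ∃ s : M ⟶ O, s ≫ i₀ = i₁ ≫ D.src)
    (ht : ∃ t : M ⟶ O, t ≫ i₀ = i₁ ≫ D.tgt) (hu : ∃ e : O ⟶ M, e ≫ i₁ = i₀ ≫ D.unit)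
    (hm : ∀ {X : C} (f g : X ⟶ M) (h : (f ≫ i₁) ≫ D.tgt = (g ≫ i₁) ≫ D.src),
      ∃ m : X ⟶ M, m ≫ i₁ = D.mul (f ≫ i₁) (g ≫ i₁) h) :
    ∃ (D' : {D' : InternalCat C // D'.obj = O ∧ D'.mor = M}) (j : D'.1 ⟶ D), Mono j ∧
      ∀ {A : InternalCat C} (G : A ⟶ D), (∃ g₀, g₀ ≫ i₀ = G.onObj) → (∃ g₁, g₁ ≫ i₁ = G.onMor) →
        ∃ G' : A ⟶ D'.1, G' ≫ j = G := by
  obtain ⟨s, hs⟩ := hs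
  obtain ⟨t, ht⟩ := ht
  obtain ⟨e, he⟩ := hu
  have hst : (pullback.fst t s ≫ i₁) ≫ D.tgt = (pullback.snd t s ≫ i₁) ≫ D.src := by
    rw [Category.assoc, Category.assoc, ← hs, ← ht, pullback.condition_assoc]
  obtain ⟨m, hm⟩ := hm (pullback.fst t s) (pullback.snd t s) hst
  let G : DetectedGraph.{v, u, 0} C :=
    { obj := O
      mor := M
      src := s
      tgt := t
      unit := e
      comp := m
      ι := Unit
      cat := fun _ => D
      onObj := fun _ => i₀
      onMor := fun _ => i₁
      onMor_src := fun _ => hs.symm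
      onMor_tgt := fun _ => ht.symm
      unit_src := by
        rw [← cancel_mono i₀, Category.assoc, hs, reassoc_of% he, D.unit_src, Category.comp_id,
          Category.id_comp]
      unit_tgt := by
        rw [← cancel_mono i₀, Category.assoc, ht, reassoc_of% he, D.unit_tgt, Category.comp_id,
          Category.id_comp]
      unit_onMor := fun _ => he
      comp_src := by
        rw [← cancel_mono i₀, Category.assoc, hs, reassoc_of% hm, mul_src, Category.assoc,
          Category.assoc, hs]
      comp_tgt := by
        rw [← cancel_mono i₀, Category.assoc, ht, reassoc_of% hm, mul_tgt, Category.assoc,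
          Category.assoc, ht]
      comp_onMor := fun _ => hm
      ext := fun _ _ h => (cancel_mono i₁).1 (h ()) }
  refine ⟨⟨G.toInternalCat, rfl, rfl⟩, G.π (), ⟨fun a b hab => ?_⟩, ?_⟩
  · exact hom_ext ((cancel_mono i₀).1 (congrArg Hom.onObj hab))
      ((cancel_mono i₁).1 (congrArg Hom.onMor hab))
  · rintro A H ⟨g₀, h₀⟩ ⟨g₁, h₁⟩
    refine ⟨G.lift (fun _ => H) g₀ g₁ ?_ ?_ (fun _ => h₀) (fun _ => h₁), hom_ext h₀ h₁⟩
    · rw [← cancel_mono i₀, Category.assoc, Category.assoc, h₀]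
      exact (congrArg (g₁ ≫ ·) hs).trans ((by rw [← Category.assoc, h₁, H.onMor_src] :
        g₁ ≫ i₁ ≫ D.src = A.src ≫ H.onObj))
    · rw [← cancel_mono i₀, Category.assoc, Category.assoc, h₀]
      exact (congrArg (g₁ ≫ ·) ht).trans ((by rw [← Category.assoc, h₁, H.onMor_tgt] :
        g₁ ≫ i₁ ≫ D.tgt = A.tgt ≫ H.onObj))

end Sub

/-- With both objects fixed, an internal category is determined by four morphisms of `C`, and
hom-sets of `C` lie in `Type v`. This is what makes the solution set below small. -/
instance small_subtype_obj_mor (O M : C) :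
    Small.{v} {D : InternalCat C // D.obj = O ∧ D.mor = M} := by
  let S : Type v := Σ (st : (M ⟶ O) × (M ⟶ O) × (O ⟶ M)), (pullback st.2.1 st.1 ⟶ M)
  let toS : {D : InternalCat C // D.obj = O ∧ D.mor = M} → S := fun D => by
    obtain ⟨D, rfl, rfl⟩ := D
    exact ⟨(D.src, D.tgt, D.unit), D.comp⟩
  refine small_of_injective (f := toS) ?_
  rintro ⟨⟨o, m, s, t, e, c, _, _, _, _, _, _, _⟩, h₀, h₁⟩
    ⟨⟨o', m', s', t', e', c', _, _, _, _, _, _, _⟩, h₀', h₁'⟩ h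
  dsimp only at h₀ h₁ h₀' h₁'
  subst h₀ h₁ h₀' h₁'
  obtain rfl : s = s' := congrArg (fun x : S => x.1.1) h
  obtain rfl : t = t' := congrArg (fun x : S => x.1.2.1) h
  obtain rfl : e = e' := congrArg (fun x : S => x.1.2.2) h
  have hc : c ≍ c' := (Sigma.ext_iff.1 h).2
  obtain rfl := eq_of_heq hc
  rfl

/-- Colimits exist as soon as every cocone factors through a cocone whose tip has its objects of
objects and of morphisms in a small family. -/
lemma hasColimitsOfShape_of_small [HasLimits (InternalCat C)] {I : Type v} [Category.{v} I]
    (h : ∀ F : I ⥤ InternalCat C, ∃ (ι : Type v) (X : ι → C), ∀ (D : InternalCat C)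
      (φ : F ⟶ (Functor.const I).obj D), ∃ (s₀ s₁ : ι)
      (D' : {D' : InternalCat C // D'.obj = X s₀ ∧ D'.mor = X s₁}) (j : D'.1 ⟶ D), Mono j ∧
        ∀ i : I, ∃ G : F.obj i ⟶ D'.1, G ≫ j = φ.app i) :
    HasColimitsOfShape I (InternalCat C) := by
  -- Colimits are a left adjoint to the constant diagram functor. That functor preserves limits, so
  -- the adjoint functor theorem leaves only the solution set condition.
  rw [hasColimitsOfShape_iff_isRightAdjoint_const]
  apply isRightAdjoint_of_preservesLimits_of_solutionSetCondition
  intro F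
  obtain ⟨ι, X, hX⟩ := h F
  let T : ι → ι → Type _ := fun s₀ s₁ => {D' : InternalCat C // D'.obj = X s₀ ∧ D'.mor = X s₁}
  let B : (Σ (s : ι × ι), Shrink.{v} (T s.1 s.2)) → InternalCat C :=
    fun s => ((equivShrink _).symm s.2).1
  refine ⟨Σ s, (F ⟶ (Functor.const I).obj (B s)), fun s => B s.1, fun s => s.2, fun D φ => ?_⟩
  obtain ⟨s₀, s₁, D', j, hj, hφ⟩ := hX D φ
  have hB : B ⟨(s₀, s₁), equivShrink _ D'⟩ = D'.1 :=
    congrArg Subtype.val (Equiv.symm_apply_apply _ _)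
  choose G hG using hφ
  -- The decoded object `B` of the code of `D'` equals `D'` only propositionally; with both sides
  -- turned into variables, `subst` transports `j` and `G`.
  generalize hs : (⟨(s₀, s₁), equivShrink _ D'⟩ : Σ (s : ι × ι), Shrink.{v} (T s.1 s.2)) = s at hB
  generalize D'.1 = D'' at j hB G hG hj
  subst hB
  refine ⟨⟨s, { app := G, naturality := fun i k f => ?_ }⟩, j, ?_⟩
  -- The factored legs form a cocone because `j` is a monomorphism and the original legs do.
  · rw [← cancel_mono j]
    have h₁ : F.map f ≫ φ.app k = φ.app i := (φ.naturality f).trans (Category.comp_id _)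
    have h₂ : G i ≫ ((Functor.const I).obj (B s)).map f = G i := Category.comp_id _
    rw [h₂, Category.assoc, hG, hG, h₁]
  · ext i
    exact hG i

end InternalCat

/-! ### Subcategories generated by sets of arrows -/

section Arrows

/-- The arrow of a category named by a functor out of `[1]`. -/
def ordinalArrow {A : Cat.{u, u}} (x : ordinalCat.{u} 1 ⟶ A) : Arrow A :=
  Arrow.mk (x.toFunctor.map (X := ULift.up 0) (Y := ULift.up 1)
    (homOfLE (Fin.zero_le (1 : Fin 2)) : ULift.up.{u} (0 : Fin 2) ⟶ ULift.up (1 : Fin 2)))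

/-- The functor out of `[1]` which names an arrow. -/
def ordinalOfArrow {A : Cat.{u, u}} (α : Arrow A) : ordinalCat.{u} 1 ⟶ A :=
  (Monotone.functor (f := (ULift.down : ULift.{u} (Fin 2) → Fin 2)) (fun _ _ h => h) ⋙
    ComposableArrows.mk₁ α.hom).toCatHom

lemma ordinalArrow_ordinalOfArrow {A : Cat.{u, u}} (α : Arrow A) :
    ordinalArrow (ordinalOfArrow α) = α := rfl

lemma ordinalOfArrow_ordinalArrow {A : Cat.{u, u}} (x : ordinalCat.{u} 1 ⟶ A) :
    ordinalOfArrow (ordinalArrow x) = x := by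
  let up := Monotone.functor (f := (ULift.up.{u} : Fin 2 → ULift.{u} (Fin 2))) (fun _ _ h => h)
  have : ComposableArrows.mk₁ (ordinalArrow x).hom = up ⋙ x.toFunctor :=
    ComposableArrows.mk₁_hom (up ⋙ x.toFunctor)
  apply Cat.Hom.ext
  exact congrArg (fun G => Monotone.functor (f := (ULift.down : ULift.{u} (Fin 2) → Fin 2))
    (fun _ _ h => h) ⋙ G) this

lemma ordinalArrow_injective {A : Cat.{u, u}} :
    Function.Injective (ordinalArrow (A := A)) :=
  Function.LeftInverse.injective ordinalOfArrow_ordinalArrow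

lemma ordinalArrow_comp {A B : Cat.{u, u}} (x : ordinalCat.{u} 1 ⟶ A) (F : A ⟶ B) :
    ordinalArrow (x ≫ F) = F.toFunctor.mapArrow.obj (ordinalArrow x) := rfl

lemma ordinalOfArrow_comp {A B : Cat.{u, u}} (α : Arrow A) (F : A ⟶ B) :
    ordinalOfArrow α ≫ F = ordinalOfArrow (F.toFunctor.mapArrow.obj α) := by
  apply ordinalArrow_injective
  rw [ordinalArrow_comp, ordinalArrow_ordinalOfArrow, ordinalArrow_ordinalOfArrow]

/-- The composite of two arrows if they are composable, and the first one otherwise. -/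
noncomputable def arrowComp {A : Type u} [Category.{u} A] (α β : Arrow A) : Arrow A :=
  open Classical in
  if h : α.right = β.left then Arrow.mk (α.hom ≫ eqToHom h ≫ β.hom) else α

lemma arrowComp_mk {A : Type u} [Category.{u} A] {a b c : A} (f : a ⟶ b) (g : b ⟶ c) :
    arrowComp (Arrow.mk f) (Arrow.mk g) = Arrow.mk (f ≫ g) := by
  rw [arrowComp, dif_pos (show (Arrow.mk f).right = (Arrow.mk g).left from rfl)]
  simp

/-- A set of arrows which is closed under sources, targets and composition. -/
structure IsArrowClosed {A : Type u} [Category.{u} A] (R : Set (Arrow A)) : Prop where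
  left {α : Arrow A} (h : α ∈ R) : Arrow.mk (𝟙 α.left) ∈ R
  right {α : Arrow A} (h : α ∈ R) : Arrow.mk (𝟙 α.right) ∈ R
  comp {α β : Arrow A} (h : α ∈ R) (h' : β ∈ R) : arrowComp α β ∈ R

/-- The objects of the subcategory of the arrows in `R`. -/
@[ext]
structure ArrowSubcategory {A : Type u} [Category.{u} A] {R : Set (Arrow A)}
    (hR : IsArrowClosed R) : Type u where
  obj : A
  mem : Arrow.mk (𝟙 obj) ∈ R

namespace ArrowSubcategory

variable {A : Type u} [Category.{u} A] {R : Set (Arrow A)} {hR : IsArrowClosed R}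

instance : Category.{u} (ArrowSubcategory hR) where
  Hom a b := {f : a.obj ⟶ b.obj // Arrow.mk f ∈ R}
  id a := ⟨𝟙 a.obj, a.mem⟩
  comp f g := ⟨f.1 ≫ g.1, arrowComp_mk f.1 g.1 ▸ hR.comp f.2 g.2⟩
  id_comp f := Subtype.ext (Category.id_comp f.1)
  comp_id f := Subtype.ext (Category.comp_id f.1)
  assoc f g h := Subtype.ext (Category.assoc f.1 g.1 h.1)

variable (hR) in
/-- The inclusion of the subcategory of the arrows in `R`. -/
def ι : ArrowSubcategory hR ⥤ A where
  obj a := a.obj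
  map f := f.1

lemma ι_mapArrow_injective : Function.Injective (ι hR).mapArrow.obj := by
  rintro ⟨⟨a, ha⟩, ⟨b, hb⟩, ⟨f, hf⟩⟩ ⟨⟨a', ha'⟩, ⟨b', hb'⟩, ⟨f', hf'⟩⟩ h
  have h : Arrow.mk f = Arrow.mk f' := h
  obtain rfl : a = a' := congrArg Arrow.leftFunc.obj h
  obtain rfl : b = b' := congrArg Arrow.rightFunc.obj h
  obtain rfl : f = f' := by simpa [Arrow.mk_eq_mk_iff] using h
  rfl

end ArrowSubcategory

variable {A B X : Cat.{u, u}}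

/-- A functor is determined by its effect on arrows, objects being recovered from their identities.
-/
lemma mono_of_mapArrow_injective (i : B ⟶ A)
    (hi : Function.Injective i.toFunctor.mapArrow.obj) : Mono i where
  right_cancellation {Z} F G h := by
    have H (α : Arrow Z) : F.toFunctor.mapArrow.obj α = G.toFunctor.mapArrow.obj α :=
      hi (congrArg (fun K : Z ⟶ A => K.toFunctor.mapArrow.obj α) h)
    apply Cat.Hom.ext
    refine Functor.hext (fun z => ?_) fun z z' f => ?_
    · exact congrArg Arrow.leftFunc.obj (H (Arrow.mk (𝟙 z)))
    · have : Arrow.mk (F.toFunctor.map f) = Arrow.mk (G.toFunctor.map f) := H (Arrow.mk f)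
      obtain ⟨h₁, h₂, h⟩ := (Arrow.mk_eq_mk_iff _ _).1 this
      rw [h]
      simp

/-- A functor factors through a functor which is injective on arrows if its arrows do. -/
lemma exists_factor_of_mapArrow_injective (i : B ⟶ A)
    (hi : Function.Injective i.toFunctor.mapArrow.obj) (F : X ⟶ A)
    (hF : ∀ α : Arrow X, ∃ β : Arrow B, i.toFunctor.mapArrow.obj β = F.toFunctor.mapArrow.obj α) :
    ∃ G : X ⟶ B, G ≫ i = F := by
  have hinj : Function.Injective i.toFunctor.obj := fun b b' h => by
    have : i.toFunctor.mapArrow.obj (Arrow.mk (𝟙 b)) =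
        i.toFunctor.mapArrow.obj (Arrow.mk (𝟙 b')) := by
      simp [Arrow.mk_eq_mk_iff, h]
    exact congrArg Arrow.leftFunc.obj (hi this)
  have hfaith {b b' : B} {f g : b ⟶ b'} (h : i.toFunctor.map f = i.toFunctor.map g) : f = g := by
    have : Arrow.mk f = Arrow.mk g := hi (congrArg Arrow.mk h)
    simpa [Arrow.mk_eq_mk_iff] using this
  have hobj (x : X) : ∃ b : B, i.toFunctor.obj b = F.toFunctor.obj x := by
    obtain ⟨β, hβ⟩ := hF (Arrow.mk (𝟙 x))
    exact ⟨β.left, congrArg Arrow.leftFunc.obj hβ⟩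
  choose o ho using hobj
  have hmap (x y : X) (f : x ⟶ y) : ∃ g : o x ⟶ o y, i.toFunctor.map g =
      eqToHom (ho x) ≫ F.toFunctor.map f ≫ eqToHom (ho y).symm := by
    -- The preimage arrow comes with its own ends; injectivity of `i` on objects identifies them
    -- with the chosen `o x` and `o y`.
    obtain ⟨⟨b, b', g⟩, hβ⟩ := hF (Arrow.mk f)
    have hl : i.toFunctor.obj b = F.toFunctor.obj x := congrArg Arrow.leftFunc.obj hβ
    have hr : i.toFunctor.obj b' = F.toFunctor.obj y := congrArg Arrow.rightFunc.obj hβ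
    obtain rfl : b = o x := hinj (hl.trans (ho x).symm)
    obtain rfl : b' = o y := hinj (hr.trans (ho y).symm)
    obtain ⟨_, _, h⟩ := (Arrow.mk_eq_mk_iff _ _).1 hβ
    exact ⟨g, h⟩
  choose m hm using hmap
  let G : X ⥤ B :=
    { obj := o
      map := fun {x y} f => m x y f
      map_id := fun x => hfaith (by simp [hm])
      map_comp := fun f g => hfaith (by simp [hm]) }
  refine ⟨G.toCatHom, Cat.Hom.ext (CategoryTheory.Functor.ext ho fun x y f => hm x y f)⟩

/-- A closed set of arrows which injects into `Ω` is the set of arrows of a subcategory which is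
isomorphic to one of the small family of categories on subsets of `Ω`. -/
lemma exists_small_arrowSubcategory {R : Set (Arrow A)} (hR : IsArrowClosed R) {Ω : Type u}
    (e : R → Ω) (he : Function.Injective e) :
    ∃ (S : SmallCategoryOfSet Ω) (i : Cat.of S.obj ⟶ A), Mono i ∧
      (∀ x : ordinalCat.{u} 1 ⟶ Cat.of S.obj, ordinalArrow (x ≫ i) ∈ R) ∧
      ∀ {X : Cat.{u, u}} (F : X ⟶ A),
        (∀ x : ordinalCat.{u} 1 ⟶ X, ordinalArrow (x ≫ F) ∈ R) → ∃ G, G ≫ i = F := by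
  -- An object is coded by the code of its identity, and a morphism by the code of its arrow.
  let f₁ : ArrowSubcategory hR → Ω := fun a => e ⟨_, a.mem⟩
  have hf₁ : Function.Injective f₁ := fun a b h =>
    ArrowSubcategory.ext (congrArg (fun α : R => α.1.left) (he h))
  let f₂ (a b : ArrowSubcategory hR) : (a ⟶ b) → Ω := fun f => e ⟨_, f.2⟩
  have hf₂ (a b : ArrowSubcategory hR) : Function.Injective (f₂ a b) := fun f g h => by
    have : Arrow.mk f.1 = Arrow.mk g.1 := congrArg Subtype.val (he h)
    exact Subtype.ext (by simpa [Arrow.mk_eq_mk_iff] using this)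
  let e₁ := Equiv.ofInjective f₁ hf₁
  let c : CoreSmallCategoryOfSet Ω (ArrowSubcategory hR) :=
    { obj := Set.range f₁
      hom := fun X Y => Set.range (f₂ (e₁.symm X) (e₁.symm Y))
      objEquiv := e₁.symm
      homEquiv := fun {X Y} => (Equiv.ofInjective _ (hf₂ _ _)).symm }
  have hi : Function.Injective (c.functor ⋙ ArrowSubcategory.ι hR).mapArrow.obj :=
    ArrowSubcategory.ι_mapArrow_injective.comp c.arrowEquiv.injective
  refine ⟨c.smallCategoryOfSet, (c.functor ⋙ ArrowSubcategory.ι hR).toCatHom,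
    mono_of_mapArrow_injective _ hi, fun x => ?_, fun {X} F hF => ?_⟩
  · exact (c.functor.map (ordinalArrow x).hom).2
  · refine exists_factor_of_mapArrow_injective _ hi F fun α => ?_
    have hα : F.toFunctor.mapArrow.obj α ∈ R := by
      have := hF (ordinalOfArrow α)
      rwa [ordinalOfArrow_comp, ordinalArrow_ordinalOfArrow] at this
    let β : Arrow (ArrowSubcategory hR) :=
      Arrow.mk (Y := ⟨_, hR.right hα⟩) (X := ⟨_, hR.left hα⟩) ⟨_, hα⟩
    obtain ⟨γ, hγ⟩ := c.arrowEquiv.surjective β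
    exact ⟨γ, congrArg (ArrowSubcategory.ι hR).mapArrow.obj hγ⟩

end Arrows

/-! ### Closure under operations -/

/-- Formal expressions in binary operations indexed by `κ`, with generators in `S`. -/
inductive OpTerm (κ : Type) (S : Type u) : Type u
  | of (s : S) : OpTerm κ S
  | op (k : κ) (a b : OpTerm κ S) : OpTerm κ S

/-- The value of a formal expression. -/
def OpTerm.eval {κ : Type} {S : Type u} {Z : Type v} (g : S → Z) (op : κ → Z → Z → Z) :
    OpTerm κ S → Z
  | .of s => g s
  | .op k a b => op k (a.eval g op) (b.eval g op)

/-! ### Generated double subcategories and cocompleteness. -/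

namespace DblCat

open InternalCat

/-- The operations of a double category, on the arrows of its two categories. -/
inductive Operation
  | left | right | comp | src | tgt | unit | mul

/-- The horizontal composite of two squares if they are composable, and the first one otherwise. -/
noncomputable def arrowMul (D : DblCat.{u}) (α β : Arrow D.mor) : Arrow D.mor :=
  open Classical in
  if h : ordinalOfArrow α ≫ D.tgt = ordinalOfArrow β ≫ D.src then
    ordinalArrow (D.mul (ordinalOfArrow α) (ordinalOfArrow β) h) else α

lemma arrowMul_ordinalArrow (D : DblCat.{u}) (x y : ordinalCat.{u} 1 ⟶ D.mor)
    (h : x ≫ D.tgt = y ≫ D.src) :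
    D.arrowMul (ordinalArrow x) (ordinalArrow y) = ordinalArrow (D.mul x y h) := by
  have h' : ordinalOfArrow (ordinalArrow x) ≫ D.tgt = ordinalOfArrow (ordinalArrow y) ≫ D.src := by
    rwa [ordinalOfArrow_ordinalArrow, ordinalOfArrow_ordinalArrow]
  rw [arrowMul, dif_pos h']
  simp only [ordinalOfArrow_ordinalArrow]

/-- The action of the operations of a double category on arrows, which is trivial where an operation
is not defined. -/
noncomputable def operate (D : DblCat.{u}) :
    Operation → Arrow D.obj ⊕ Arrow D.mor → Arrow D.obj ⊕ Arrow D.mor → Arrow D.obj ⊕ Arrow D.mor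
  | .left, .inl α, _ => .inl (Arrow.mk (𝟙 α.left))
  | .left, .inr α, _ => .inr (Arrow.mk (𝟙 α.left))
  | .right, .inl α, _ => .inl (Arrow.mk (𝟙 α.right))
  | .right, .inr α, _ => .inr (Arrow.mk (𝟙 α.right))
  | .comp, .inl α, .inl β => .inl (arrowComp α β)
  | .comp, .inr α, .inr β => .inr (arrowComp α β)
  | .src, .inr α, _ => .inl (D.src.toFunctor.mapArrow.obj α)
  | .tgt, .inr α, _ => .inl (D.tgt.toFunctor.mapArrow.obj α)
  | .unit, .inl α, _ => .inr (D.unit.toFunctor.mapArrow.obj α)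
  | .mul, .inr α, .inr β => .inr (D.arrowMul α β)
  | _, z, _ => z

/-- Every family of double functors to `D` factors through a double category whose size is bounded
by that of the sources. -/
lemma exists_small_factorization {I : Type u} (A : I → DblCat.{u}) :
    ∃ Ω : Type u, ∀ (D : DblCat.{u}) (φ : ∀ i, A i ⟶ D), ∃ (S₀ S₁ : SmallCategoryOfSet Ω)
      (D' : {D' : DblCat.{u} // D'.obj = Cat.of S₀.obj ∧ D'.mor = Cat.of S₁.obj}) (j : D'.1 ⟶ D),
      Mono j ∧ ∀ i, ∃ G : A i ⟶ D'.1, G ≫ j = φ i := by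
  -- The set of formal terms depends on the sources only, not on `D` or φ. Each arrow generated by
  -- the images of the φ i is the value of some term, and choosing one such term codes the arrows
  -- injectively.
  refine ⟨OpTerm Operation (Σ i, Arrow (A i).obj ⊕ Arrow (A i).mor), fun D φ => ?_⟩
  let g : (Σ i, Arrow (A i).obj ⊕ Arrow (A i).mor) → Arrow D.obj ⊕ Arrow D.mor := fun s =>
    Sum.map (φ s.1).onObj.toFunctor.mapArrow.obj (φ s.1).onMor.toFunctor.mapArrow.obj s.2
  let R : Set (Arrow D.obj ⊕ Arrow D.mor) := Set.range (OpTerm.eval g D.operate)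
  have hop (k : Operation) {a b} (ha : a ∈ R) (hb : b ∈ R) : D.operate k a b ∈ R := by
    obtain ⟨a, rfl⟩ := ha
    obtain ⟨b, rfl⟩ := hb
    exact ⟨.op k a b, rfl⟩
  let R₀ : Set (Arrow D.obj) := {α | Sum.inl α ∈ R}
  let R₁ : Set (Arrow D.mor) := {α | Sum.inr α ∈ R}
  have hR₀ : IsArrowClosed R₀ :=
    ⟨fun h => hop .left h h, fun h => hop .right h h, fun h h' => hop .comp h h'⟩
  have hR₁ : IsArrowClosed R₁ :=
    ⟨fun h => hop .left h h, fun h => hop .right h h, fun h h' => hop .comp h h'⟩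
  obtain ⟨S₀, i₀, hi₀, hmem₀, hfac₀⟩ := exists_small_arrowSubcategory hR₀
    (fun α => Classical.choose α.2) fun α β h => Subtype.ext (Sum.inl_injective (by
      rw [← Classical.choose_spec α.2, ← Classical.choose_spec β.2]
      exact congrArg _ h))
  obtain ⟨S₁, i₁, hi₁, hmem₁, hfac₁⟩ := exists_small_arrowSubcategory hR₁
    (fun α => Classical.choose α.2) fun α β h => Subtype.ext (Sum.inr_injective (by
      rw [← Classical.choose_spec α.2, ← Classical.choose_spec β.2]
      exact congrArg _ h))
  obtain ⟨D', j, hj, hlift⟩ := D.exists_subcategory i₀ i₁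
    (hfac₀ _ fun x => hop .src (hmem₁ x) (hmem₁ x))
    (hfac₀ _ fun x => hop .tgt (hmem₁ x) (hmem₁ x))
    (hfac₁ _ fun x => hop .unit (hmem₀ x) (hmem₀ x))
    (fun {X} f g h => hfac₁ _ fun x => by
      -- Membership is tested on functors [1] → X, and composing with `x` turns the product of
      -- generalized elements into the operation `mul` on two arrows of the generated set.
      have hx : (x ≫ f ≫ i₁) ≫ D.tgt = (x ≫ g ≫ i₁) ≫ D.src := by
        simp only [Category.assoc] at h ⊢
        rw [h]
      rw [comp_mul, ← D.arrowMul_ordinalArrow _ _ hx]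
      exact hop .mul (hmem₁ (x ≫ f)) (hmem₁ (x ≫ g)))
  refine ⟨S₀, S₁, D', j, hj, fun i => hlift (φ i) ?_ ?_⟩
  · exact hfac₀ _ fun x => ⟨.of ⟨i, .inl (ordinalArrow x)⟩, rfl⟩
  · exact hfac₁ _ fun x => ⟨.of ⟨i, .inr (ordinalArrow x)⟩, rfl⟩

instance : HasColimits DblCat.{u} where
  has_colimits_of_shape I _ := by
    apply hasColimitsOfShape_of_small
    intro F
    obtain ⟨Ω, hΩ⟩ := exists_small_factorization F.obj
    refine ⟨SmallCategoryOfSet Ω, fun S => Cat.of S.obj, fun D φ => ?_⟩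
    exact hΩ D fun i => φ.app i

end DblCat

/-- The simplicially surjective topology `τ` on `Cat` determines a model structure on the complete
and cocomplete category of small double categories, with the weak equivalences `we(τ)`, fibrations
`fib(τ)` and cofibrations `cof(τ)`; a double functor is in `we(τ)` if and only if its vertical nerve
is levelwise an equivalence of categories; and `Cat` has enough `τ`-projectives. -/
theorem mainTheorem4 :
    HasLimits DblCat.{u} ∧ HasColimits DblCat.{u} ∧
    (∃ M : HomotopicalAlgebra.ModelCategory DblCat.{u},
      HomotopicalAlgebra.weakEquivalences DblCat.{u} =
          InternalCat.we simpliciallySurjectiveTopology.{u} ∧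
        HomotopicalAlgebra.fibrations DblCat.{u} =
          InternalCat.fib simpliciallySurjectiveTopology.{u} ∧
        HomotopicalAlgebra.cofibrations DblCat.{u} =
          InternalCat.cof simpliciallySurjectiveTopology.{u}) ∧
    (∀ {D E : DblCat.{u}} (F : D ⟶ E),
      InternalCat.we simpliciallySurjectiveTopology.{u} F ↔
        ∀ k : ℕ, (DblCat.verticalNerveMap F k).IsEquivalence) ∧
    EnoughTopologyProjectives simpliciallySurjectiveTopology.{u} := by
  refine ⟨inferInstance, inferInstance, ?_, fun F => DblCat.we_iff_isEquivalence F,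
    enoughTopologyProjectives_simpliciallySurjective⟩
  exact InternalCat.exists_modelCategory isTopologyEpi_iff_liftsFrom
    enoughTopologyProjectives_simpliciallySurjective
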